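/- Let $k$ be a field and let $\mathcal C$ be a symmetric rigid tensor category over $k$: a rigid, $k$-linear abelian symmetric monoidal category with $k$-bilinear tensor product, finite dimensional $\mathrm{Hom}$ spaces, all objects of finite length, and $\mathrm{End}(\mathbf 1)=k$. Let $c$ be its commutativity constraint. Let $m\ge 1$ be an integer with $\mathrm{char}(k)=0$ or $\mathrm{char}(k)>m$, let $\alpha$ be a partition of $m-1$, and let $\beta$ be a partition of $m$ whose Young diagram is obtained from that of $\alpha$ by adding one box. Let $p(\beta)$ and $q(\beta)$ be the numbers of rows and columns of $\beta$. Let $X\in\mathcal C$, with dimension $d=\dim X:=ev_X\circ c_{X,X^*}\circ coev_X\in \mathrm{End}(\mathbf 1)=k$. The group $S_m$ acts on $X^{\otimes m}$ through $c$, and $S_{m-1}$ is identified with the stabilizer of $1$ in $S_m$, acting on the last $m-1$ factors of $X\otimes X^{\otimes m-1}$. For a bijective numbering $T_\beta$ of the boxes of $\beta$ by $1,\dots,m$, let $c_\beta=\big(\sum_{\sigma}\sigma\big)\big(\sum_{\tau}\mathrm{sgn}(\tau)\tau\big)\in k[S_m]$ be its Young symmetrizer, where $\sigma$ (respectively $\tau$)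 runs over the permutations preserving the rows (respectively columns) of $T_\beta$, and let $\mathbb S_\beta X:=c_\beta(X^{\otimes m})$ be the image of $c_\beta$ on $X^{\otimes m}$. For a bijective numbering $T_\alpha$ of the boxes of $\alpha$ by $2,\dots,m$ define $c_\alpha\in k[S_{m-1}]\subseteq k[S_m]$ and $\mathbb S_\alpha X\subseteq X^{\otimes m-1}$ likewise, and write $\mathbb S_\alpha X^*$ for the dual $(\mathbb S_\alpha X)^*$. Let $$\theta_{\alpha,\beta}:X\xrightarrow{\ id_X\otimes coev_{\mathbb S_\alpha X}\ }X\otimes \mathbb S_\alpha X\otimes \mathbb S_\alpha X^*\xrightarrow{\ c_\beta\otimes id\ }\mathbb S_\beta X\otimes \mathbb S_\alpha X^* ,$$ where $c_\beta$ is applied to $X\otimes \mathbb S_\alpha X\subseteq X^{\otimes m}$. If $T_\beta$ extends $T_\alpha$ (so that the added box has number $1$), then $c_\beta c_\alpha\ne 0$ in $k[S_m]$. Moreover, for any choice of $T_\alpha$ and $T_\beta$ with $c_\beta c_\alpha\neq 0$ in $k[S_m]$: 1) If $d\ne 1-q(\beta),\dots,p(\beta)-1$ in $k$, then $\theta_{\alpha,\beta}$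 is a split injection. 2) Suppose $\beta$ is a hook, that is, $\beta$ does not contain the box in row $2$ and column $2$. If $d\ne 1-q(\beta),\dots,-1,1,\dots,p(\beta)-1$ in $k$, then $\theta_{\alpha,\beta}$ is a split injection. -/

import Mathlib

open CategoryTheory MonoidalCategory

namespace SchurFunctor

section TensorPower

universe v u
variable {C : Type u} [Category.{v} C] [MonoidalCategory C]

/-- The tensor power `X ⊗ (X ⊗ (⋯ ⊗ 𝟙))` with `n` factors. -/
@[reducible] def tensorPow (X : C) : ℕ → C
  | 0 => 𝟙_ C
  | n + 1 => X ⊗ tensorPow X n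

variable [SymmetricCategory C]

/-- The symmetry exchanging the first two factors of `X ⊗ (X ⊗ Z)`. -/
def swapFirst (X Z : C) : X ⊗ (X ⊗ Z) ⟶ X ⊗ (X ⊗ Z) :=
  (α_ X X Z).inv ≫ (β_ X X).hom ▷ Z ≫ (α_ X X Z).hom

/-- The symmetry that moves the first factor of `X ^ (n + 1)` to position `j`, past the `j` factors
at the positions `1, …, j`, and keeps the order of the others (for `j ≤ n`). -/
def moveFirst (X : C) : (n : ℕ) → ℕ → (tensorPow X (n + 1) ⟶ tensorPow X (n + 1))
  | _, 0 => 𝟙 _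
  | 0, _ + 1 => 𝟙 _
  | n + 1, j + 1 => swapFirst X (tensorPow X n) ≫ X ◁ moveFirst X n j

/-- The permutation of the remaining positions when position `0` is deleted from the source and
position `σ 0` from the target. -/
def permTail {n : ℕ} (σ : Equiv.Perm (Fin (n + 1))) : Equiv.Perm (Fin n) :=
  Equiv.removeNone ((finSuccEquiv' 0).symm.trans (σ.trans (finSuccEquiv' (σ 0))))

/-- The symmetry of `X ^ n` that moves the factor at position `i` to position `σ i`. -/
def permMap (X : C) : (n : ℕ) → Equiv.Perm (Fin n) → (tensorPow X n ⟶ tensorPow X n)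
  | 0, _ => 𝟙 _
  | n + 1, σ => X ◁ permMap X n (permTail σ) ≫ moveFirst X n (σ 0)

theorem permTail_spec {n : ℕ} (σ : Equiv.Perm (Fin (n + 1))) (i : Fin n) :
    (σ 0).succAbove (permTail σ i) = σ i.succ := by
  have h := Equiv.removeNone_some
    ((finSuccEquiv' 0).symm.trans (σ.trans (finSuccEquiv' (σ 0)))) (x := i) (by
      have hne : σ i.succ ≠ σ 0 := fun h => Fin.succ_ne_zero i (σ.injective h)
      obtain ⟨y, hy⟩ := Fin.exists_succAbove_eq hne
      exact ⟨y, by simp [← hy]⟩)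
  have h' : some (permTail σ i) = finSuccEquiv' (σ 0) (σ i.succ) := by
    simpa [permTail] using h
  exact (finSuccEquiv'_eq_some.1 h'.symm).symm

theorem permTail_unique {n : ℕ} {σ : Equiv.Perm (Fin (n + 1))} {τ : Equiv.Perm (Fin n)}
    (h : ∀ i, (σ 0).succAbove (τ i) = σ i.succ) : permTail σ = τ :=
  Equiv.ext fun i => Fin.succAbove_right_injective ((permTail_spec σ i).trans (h i).symm)

theorem swapFirst_swapFirst (X Z : C) : swapFirst X Z ≫ swapFirst X Z = 𝟙 _ := by
  simp [swapFirst, ← comp_whiskerRight_assoc]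

theorem swapFirst_naturality (X : C) {Z W : C} (f : Z ⟶ W) :
    swapFirst X Z ≫ X ◁ X ◁ f = X ◁ X ◁ f ≫ swapFirst X W := by
  simp only [swapFirst, Category.assoc, ← associator_naturality_right]
  rw [← whisker_exchange_assoc, ← associator_inv_naturality_right_assoc]

theorem swapFirst_braid (X Z : C) :
    swapFirst X (X ⊗ Z) ≫ X ◁ swapFirst X Z ≫ swapFirst X (X ⊗ Z) =
      X ◁ swapFirst X Z ≫ swapFirst X (X ⊗ Z) ≫ X ◁ swapFirst X Z := by
  have h := congrArg (fun f => X ◁ (α_ X X Z).inv ≫ (α_ X (X ⊗ X) Z).inv ≫ f ▷ Z ≫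
    (α_ X (X ⊗ X) Z).hom ≫ X ◁ (α_ X X Z).hom) (BraidedCategory.yang_baxter X X X)
  simp only [swapFirst]
  simp only [comp_whiskerRight, Category.assoc] at h
  refine Eq.trans ?_ (h.trans ?_)
  · monoidal
  · monoidal

theorem moveFirst_comm (X : C) : ∀ (n a b : ℕ), a ≤ b → b ≤ n →
    swapFirst X (tensorPow X n) ≫ X ◁ moveFirst X n a ≫ moveFirst X (n + 1) (b + 1) =
      X ◁ moveFirst X n b ≫ moveFirst X (n + 1) a
  | n, 0, b, _, _ => by
      simp only [moveFirst, MonoidalCategory.whiskerLeft_id, Category.id_comp, Category.comp_id]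
      rw [← Category.assoc, swapFirst_swapFirst, Category.id_comp]
  | 0, a + 1, b, h1, h2 => by omega
  | n + 1, a + 1, 0, h1, h2 => by omega
  | n + 1, a + 1, b + 1, h1, h2 => by
      have ih := moveFirst_comm X n a b (by omega) (by omega)
      have e1 : moveFirst X (n + 1) (a + 1) =
        swapFirst X (tensorPow X n) ≫ X ◁ moveFirst X n a := rfl
      have e2 (c : ℕ) : moveFirst X (n + 1 + 1) (c + 1) =
        swapFirst X (X ⊗ tensorPow X n) ≫ X ◁ moveFirst X (n + 1) c := rfl
      have e3 : moveFirst X (n + 1) (b + 1) =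
        swapFirst X (tensorPow X n) ≫ X ◁ moveFirst X n b := rfl
      have e4 : tensorPow X (n + 1) = X ⊗ tensorPow X n := rfl
      rw [e2 (b + 1), e2 a, e1]
      simp only [MonoidalCategory.whiskerLeft_comp, Category.assoc]
      change swapFirst X (X ⊗ tensorPow X n) ≫ _ = _
      have nat1 := swapFirst_naturality X (moveFirst X n a)
      have nat2 := swapFirst_naturality X (moveFirst X n b)
      have br := swapFirst_braid X (tensorPow X n)
      have ih' := congrArg (fun f => X ◁ f) ih
      simp only [MonoidalCategory.whiskerLeft_comp] at ih'
      rw [reassoc_of% (show X ◁ X ◁ moveFirst X n a ≫ swapFirst X (X ⊗ tensorPow X n) =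
        swapFirst X (X ⊗ tensorPow X n) ≫ X ◁ X ◁ moveFirst X n a from nat1.symm)]
      rw [reassoc_of% br, ih', e3]
      simp only [MonoidalCategory.whiskerLeft_comp, Category.assoc]
      rw [reassoc_of% (show X ◁ X ◁ moveFirst X n b ≫ swapFirst X (X ⊗ tensorPow X n) =
        swapFirst X (X ⊗ tensorPow X n) ≫ X ◁ X ◁ moveFirst X n b from nat2.symm)]

/-- The symmetry exchanging the factors of `X ^ (n + 1)` at positions `i` and `i + 1`. -/
def adjacentSwap (X : C) : (n : ℕ) → Fin n → (tensorPow X (n + 1) ⟶ tensorPow X (n + 1))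
  | n + 1, i => Fin.cases (swapFirst X (tensorPow X n)) (fun j => X ◁ adjacentSwap X n j) i

theorem permTail_one (n : ℕ) : permTail (1 : Equiv.Perm (Fin (n + 1))) = 1 :=
  permTail_unique fun i => by simp

theorem permMap_one (X : C) : ∀ n : ℕ, permMap X n 1 = 𝟙 _
  | 0 => rfl
  | n + 1 => by
      have h : moveFirst X n ((1 : Equiv.Perm (Fin (n + 1))) 0 : Fin (n + 1)) = 𝟙 _ := by
        cases n <;> simp [moveFirst]
      rw [permMap, permTail_one, permMap_one X n, h]
      simp [tensorPow]

theorem succAbove_exchange {n : ℕ} {a b : Fin (n + 2)} {a' b' : Fin (n + 1)}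
    (h : a.succAbove b' = b) (h' : b.succAbove a' = a) (x : Fin n) :
    a.succAbove (b'.succAbove x) = b.succAbove (a'.succAbove x) := by
  simp only [Fin.succAbove, Fin.ext_iff, Fin.lt_def, Fin.val_castSucc, apply_ite Fin.val,
    Fin.val_succ] at *
  split_ifs at * <;> omega

theorem succAbove_values {n : ℕ} {a b : Fin (n + 2)} {a' b' : Fin (n + 1)}
    (h : a.succAbove b' = b) (h' : b.succAbove a' = a) :
    ((a : ℕ) ≤ b' ∧ (a' : ℕ) = a ∧ (b : ℕ) = b' + 1) ∨
      ((b : ℕ) ≤ a' ∧ (a : ℕ) = a' + 1 ∧ (b' : ℕ) = b) := by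
  simp only [Fin.succAbove, Fin.ext_iff, Fin.lt_def, Fin.val_castSucc, apply_ite Fin.val,
    Fin.val_succ] at *
  split_ifs at * <;> omega

theorem permMap_mul_adjacent (X : C) : ∀ (n : ℕ) (i : Fin n) (σ : Equiv.Perm (Fin (n + 1))),
    permMap X (n + 1) (σ * Equiv.swap i.castSucc i.succ) =
      adjacentSwap X n i ≫ permMap X (n + 1) σ
  | n + 1, i, σ => by
      refine Fin.cases ?_ (fun j => ?_) i
      · set τ := σ * Equiv.swap (Fin.castSucc (0 : Fin (n + 1))) (Fin.succ 0) with hτ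
        have h0 : τ 0 = σ 1 := by simp [hτ]
        have h1 : τ 1 = σ 0 := by simp [hτ]
        have h2 : ∀ i : Fin n, τ i.succ.succ = σ i.succ.succ := fun i => by
          simp only [hτ, Equiv.Perm.mul_apply]
          rw [Equiv.swap_apply_of_ne_of_ne] <;> simp [Fin.ext_iff]
        have a0 := permTail_spec σ 0
        have b0 := permTail_spec τ 0
        change (σ 0).succAbove (permTail σ 0) = σ 1 at a0
        change (τ 0).succAbove (permTail τ 0) = τ 1 at b0
        rw [h0, h1] at b0
        have tt : permTail (permTail τ) = permTail (permTail σ) := by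
          refine permTail_unique fun i => ?_
          refine Fin.succAbove_right_injective (p := τ 0) ?_
          rw [permTail_spec τ, h2, ← permTail_spec σ, ← permTail_spec (permTail σ), h0]
          exact (succAbove_exchange a0 b0 _).symm
        have key : X ◁ moveFirst X n (permTail τ 0 : Fin (n + 1)) ≫
            moveFirst X (n + 1) (σ 1 : Fin (n + 1 + 1)) =
            swapFirst X (tensorPow X n) ≫ X ◁ moveFirst X n (permTail σ 0 : Fin (n + 1)) ≫
              moveFirst X (n + 1) (σ 0 : Fin (n + 1 + 1)) := by
          rcases succAbove_values a0 b0 with ⟨hle, e1, e2⟩ | ⟨hle, e1, e2⟩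
          · rw [e1, e2, ← moveFirst_comm X n _ _ hle (Nat.le_of_lt_succ (permTail σ 0).2),
              reassoc_of% (swapFirst_swapFirst X (tensorPow X n))]
          · rw [e1, e2, ← moveFirst_comm X n _ _ hle (Nat.le_of_lt_succ (permTail τ 0).2)]
        have nat := swapFirst_naturality X (permMap X n (permTail (permTail σ)))
        rw [permMap, permMap, tt, h0, permMap, permMap]
        simp only [MonoidalCategory.whiskerLeft_comp, Category.assoc]
        rw [key, reassoc_of% (show X ◁ X ◁ permMap X n (permTail (permTail σ)) ≫
          swapFirst X (tensorPow X n) = swapFirst X (tensorPow X n) ≫ _ from nat.symm)]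
        rfl
      · set τ := σ * Equiv.swap (Fin.castSucc j.succ) (Fin.succ j.succ) with hτ
        have h0 : τ 0 = σ 0 := by
          simp only [hτ, Equiv.Perm.mul_apply]
          rw [Equiv.swap_apply_of_ne_of_ne] <;> simp [Fin.ext_iff]
        have tt : permTail τ = permTail σ * Equiv.swap j.castSucc j.succ := by
          refine permTail_unique fun i => ?_
          rw [h0, Equiv.Perm.mul_apply, permTail_spec, hτ, Equiv.Perm.mul_apply,
            ← Fin.succ_castSucc, Equiv.swap_apply_def, Equiv.swap_apply_def]
          simp only [Fin.succ_inj]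
          split_ifs <;> rfl
        rw [permMap, tt, permMap_mul_adjacent X n j (permTail σ), h0]
        have e : adjacentSwap X (n + 1) j.succ = X ◁ adjacentSwap X n j := rfl
        rw [e, permMap.eq_2 X (n + 1) σ, MonoidalCategory.whiskerLeft_comp, Category.assoc]

theorem permMap_mul (X : C) : ∀ (n : ℕ) (σ τ : Equiv.Perm (Fin n)),
    permMap X n (σ * τ) = permMap X n τ ≫ permMap X n σ
  | 0, _, _ => (Category.id_comp _).symm
  | n + 1, σ, τ => by
      have h : τ ∈ Submonoid.closure
          (Set.range fun i : Fin n => Equiv.swap i.castSucc i.succ) := by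
        rw [Equiv.Perm.mclosure_swap_castSucc_succ]; trivial
      induction h using Submonoid.closure_induction generalizing σ with
      | mem x hx =>
        obtain ⟨i, rfl⟩ := hx
        have h1 := permMap_mul_adjacent X n i 1
        rw [one_mul, permMap_one, Category.comp_id] at h1
        rw [h1]
        exact permMap_mul_adjacent X n i σ
      | one => rw [mul_one, permMap_one, Category.id_comp]
      | mul x y _ _ hx hy => rw [← mul_assoc, hy, hx, hy x, Category.assoc]

/-- The action of the symmetric group on `X ^ n` through the symmetry of the category. -/
def permAction (X : C) (n : ℕ) : Equiv.Perm (Fin n) →* End (tensorPow X n) where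
  toFun := permMap X n
  map_one' := permMap_one X n
  map_mul' := permMap_mul X n

theorem permAction_adjacent (X : C) (n : ℕ) (i : Fin n) :
    permAction X (n + 1) (Equiv.swap i.castSucc i.succ) = adjacentSwap X n i := by
  have h := permMap_mul_adjacent X n i 1
  rwa [one_mul, permMap_one, Category.comp_id] at h

end TensorPower

section GroupAlgebra

universe w v u

/-- The action of the group algebra `k[S_n]` on `X ^ n`. -/
noncomputable def groupAlgebraAction (k : Type w) [Field k] {C : Type u} [Category.{v} C]
    [Preadditive C] [Linear k C] [MonoidalCategory C] [SymmetricCategory C] (X : C) (n : ℕ) :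
    MonoidAlgebra k (Equiv.Perm (Fin n)) →ₐ[k] End (tensorPow X n) :=
  MonoidAlgebra.lift k (End (tensorPow X n)) (Equiv.Perm (Fin n)) (permAction X n)

/-- The inclusion `k[S_n] → k[S_(n+1)]` identifying `S_n` with the stabilizer of the first
position. -/
noncomputable def groupAlgebraIncl (k : Type w) [Field k] (n : ℕ) :
    MonoidAlgebra k (Equiv.Perm (Fin n)) →ₐ[k] MonoidAlgebra k (Equiv.Perm (Fin (n + 1))) :=
  MonoidAlgebra.mapDomainAlgHom k k (Equiv.Perm.viaEmbeddingHom (Fin.succEmb n))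

/-- A tableau of shape `μ`: a bijective numbering of the boxes of `μ` by the `n` tensor positions.
The box in row `i` and column `j` is `(i, j)`, with `i` and `j` counted from `0`. -/
abbrev Tableau (μ : YoungDiagram) (n : ℕ) := Fin n ≃ μ.cells

/-- The sum of the permutations that preserve every row of `T`. -/
noncomputable def rowSymmetrizer (k : Type w) [Field k] {μ : YoungDiagram} {n : ℕ}
    (T : Tableau μ n) : MonoidAlgebra k (Equiv.Perm (Fin n)) :=
  ∑ σ : Equiv.Perm (Fin n) with ∀ i, (T (σ i)).1.1 = (T i).1.1, MonoidAlgebra.single σ 1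

/-- The signed sum of the permutations that preserve every column of `T`. -/
noncomputable def colAntisymmetrizer (k : Type w) [Field k] {μ : YoungDiagram} {n : ℕ}
    (T : Tableau μ n) : MonoidAlgebra k (Equiv.Perm (Fin n)) :=
  ∑ σ : Equiv.Perm (Fin n) with ∀ i, (T (σ i)).1.2 = (T i).1.2,
    MonoidAlgebra.single σ ((Equiv.Perm.sign σ : ℤ) : k)

/-- The Young symmetrizer `c_T = a_T b_T` of a tableau. -/
noncomputable def youngSymmetrizer (k : Type w) [Field k] {μ : YoungDiagram} {n : ℕ}
    (T : Tableau μ n) : MonoidAlgebra k (Equiv.Perm (Fin n)) :=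
  rowSymmetrizer k T * colAntisymmetrizer k T

/-- A Young diagram is a hook if it does not contain the box in the second row and second column. -/
def IsHook (μ : YoungDiagram) : Prop := (1, 1) ∉ μ

end GroupAlgebra

section TensorCategory

universe w v u

/-- The finiteness conditions on a (rigid, `k`-linear, abelian) tensor category: finite dimensional
`Hom` spaces, every object of finite length, and `End 𝟙 = k`. -/
class IsTensorCategory (k : Type w) [Field k] (C : Type u) [Category.{v} C] [Abelian C]
    [Linear k C] [MonoidalCategory C] : Prop where
  finite_hom : ∀ X Y : C, Module.Finite k (X ⟶ Y)
  noetherian : ∀ X : C, IsNoetherianObject X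
  artinian : ∀ X : C, IsArtinianObject X
  end_unit : Function.Bijective (algebraMap k (End (𝟙_ C)))

variable (k : Type w) [Field k] {C : Type u} [Category.{v} C] [Abelian C] [Linear k C]
  [MonoidalCategory C] [SymmetricCategory C] [RightRigidCategory C]

/-- The dimension of `X`: the element of `k = End 𝟙` given by `ev ∘ c ∘ coev`. -/
noncomputable def dim [IsTensorCategory k C] (X : C) : k :=
  (Equiv.ofBijective _ (IsTensorCategory.end_unit (k := k) (C := C))).symm
    (η_ X Xᘁ ≫ (β_ X Xᘁ).hom ≫ ε_ X Xᘁ : 𝟙_ C ⟶ 𝟙_ C)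

/-- The endomorphism of `X ^ n` given by the Young symmetrizer of `T`. -/
noncomputable def youngMap {μ : YoungDiagram} {n : ℕ} (T : Tableau μ n) (X : C) :
    tensorPow X n ⟶ tensorPow X n :=
  groupAlgebraAction k X n (youngSymmetrizer k T)

/-- The Schur functor on objects: the image of the Young symmetrizer on `X ^ n`. -/
noncomputable def schur {μ : YoungDiagram} {n : ℕ} (T : Tableau μ n) (X : C) : C :=
  Limits.image (youngMap k T X)

/-- The morphism `θ : X ⟶ S_β X ⊗ (S_α X)ᘁ`: first `id ⊗ coev` for `S_α X`, then the Young
symmetrizer of `β` on `X ⊗ S_α X ⊆ X ⊗ X ^ n = X ^ (n + 1)`. -/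
noncomputable def theta {α β : YoungDiagram} {n : ℕ} (S : Tableau α n) (T : Tableau β (n + 1))
    (X : C) : X ⟶ schur k T X ⊗ (schur k S X)ᘁ :=
  (ρ_ X).inv ≫ X ◁ η_ (schur k S X) (schur k S X)ᘁ ≫
    (α_ X (schur k S X) (schur k S X)ᘁ).inv ≫
      (X ◁ Limits.image.ι (youngMap k S X) ≫ Limits.factorThruImage (youngMap k T X)) ▷
        (schur k S X)ᘁ

end TensorCategory

end SchurFunctor

/-! Let `x` be in the group algebra of S_(n+1), acting on X^(n+1), and close up the first n factors
by partial traces. What remains is a scalar multiple of the identity of X: each cycle of a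
permutation that avoids the last position contributes a factor d = dim X, and the cycle through the
last position contributes the identity. This scalar is the coefficient at 1 of `x * contentElement d
n`, where `contentElement d n` is the product of d + J over the nonzero Jucys-Murphy elements J
(`exists_groupAlgebraAction_eq_traceFirst`). If it is nonzero, dividing by it gives a retraction
(`isSplitAlong_groupAlgebraAction`).

A retraction of `theta` may first multiply c_β c_α by any permutation. Hence one nonzero coefficient
of the product of c_β c_α with the content element, at whatever permutation, is enough
(`isSplitMono_theta`). The content element is central (`commute_contentElement`) and multiplies c_β
by the product of d + j - i over the boxes (i, j) ≠ (0, 0) (`contentElement_mul_youngSymmetrizer`).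
So `theta` splits if c_β c_α ≠ 0 and d ≠ i - j for all these boxes. The values i - j lie between 1 -
q(β) and p(β) - 1, and in a hook the value 0 occurs only at the excluded corner (0, 0).

For compatible tableaux, c_β c_α ≠ 0 because its vanishing would force c_β c_β = 0, although c_β has
coefficient 1 at the identity (`youngSymmetrizer_mul_groupAlgebraIncl_ne_zero`). -/

namespace SchurFunctor

/-! ### Character-weighted sums over subgroups, and the trace form on a group algebra. -/

section TwistedSum

open scoped Classical in
/-- The sum of the elements of the subgroup `H`, weighted by the character `χ`. -/
noncomputable def twistedSum {k : Type*} [Field k] {G : Type*} [Group G] [Fintype G]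
    (χ : G →* kˣ) (H : Subgroup G) : MonoidAlgebra k G :=
  ∑ σ : G with σ ∈ H, MonoidAlgebra.single σ (χ σ : k)

theorem coeff_one_mul_comm {k : Type*} [Field k] {G : Type*} [Group G]
    (x y : MonoidAlgebra k G) : (x * y).coeff 1 = (y * x).coeff 1 := by
  classical
  induction x using MonoidAlgebra.induction_linear with
  | zero => simp
  | add f g hf hg => simp [add_mul, mul_add, hf, hg]
  | single a r =>
    induction y using MonoidAlgebra.induction_linear with
    | zero => simp
    | add f g hf hg => simp [add_mul, mul_add, hf, hg]
    | single b s =>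
      simp only [MonoidAlgebra.single_mul_single, MonoidAlgebra.coeff_single, Finsupp.single_apply,
        mul_comm r s]
      simp only [mul_eq_one_iff_eq_inv, eq_comm (a := a), inv_eq_iff_eq_inv]

variable {k : Type*} [Field k] {G : Type*} [Group G] [Fintype G] (χ : G →* kˣ) (H : Subgroup G)

theorem twistedSum_eq [Fintype H] : twistedSum χ H = ∑ σ : H, (χ σ : k) • MonoidAlgebra.of k G σ := by
  classical
  rw [twistedSum, Finset.sum_subtype (p := (· ∈ H)) _ (by simp)]
  refine Finset.sum_congr rfl fun σ _ => ?_
  simp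

theorem of_mul_twistedSum {h : G} (hh : h ∈ H) :
    MonoidAlgebra.of k G h * twistedSum χ H = ((χ h⁻¹ : kˣ) : k) • twistedSum χ H := by
  have : Fintype H := Fintype.ofFinite H
  rw [twistedSum_eq, Finset.mul_sum, Finset.smul_sum]
  refine Fintype.sum_equiv (Equiv.mulLeft (⟨h, hh⟩ : H)) _ _ fun x => ?_
  simp only [Equiv.coe_mulLeft, Subgroup.coe_mul, map_mul, mul_smul_comm, smul_smul]
  congr 1
  rw [← Units.val_mul]
  simp

theorem twistedSum_mul_of {h : G} (hh : h ∈ H) :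
    twistedSum χ H * MonoidAlgebra.of k G h = ((χ h⁻¹ : kˣ) : k) • twistedSum χ H := by
  have : Fintype H := Fintype.ofFinite H
  rw [twistedSum_eq, Finset.sum_mul, Finset.smul_sum]
  refine Fintype.sum_equiv (Equiv.mulRight (⟨h, hh⟩ : H)) _ _ fun x => ?_
  simp only [Equiv.coe_mulRight, Subgroup.coe_mul, map_mul, smul_mul_assoc, smul_smul]
  congr 1
  rw [← Units.val_mul]
  congr 1
  simp [mul_comm]

theorem twistedSum_mul_twistedSum {K : Subgroup G} (h : K ≤ H) :
    twistedSum χ H * twistedSum χ K = (Nat.card K : k) • twistedSum χ H := by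
  have : Fintype K := Fintype.ofFinite K
  have e (x : K) : twistedSum χ H * ((χ x : k) • MonoidAlgebra.of k G x) = twistedSum χ H := by
    rw [mul_smul_comm, twistedSum_mul_of χ H (h x.2), smul_smul, ← Units.val_mul, ← map_mul]
    simp
  rw [twistedSum_eq χ K, Finset.mul_sum, Finset.sum_congr rfl fun x _ => e x]
  simp [Nat.card_eq_fintype_card, ← Nat.cast_smul_eq_nsmul k]

theorem twistedSum_mul_twistedSum' {K : Subgroup G} (h : K ≤ H) :
    twistedSum χ K * twistedSum χ H = (Nat.card K : k) • twistedSum χ H := by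
  have : Fintype K := Fintype.ofFinite K
  have e (x : K) : ((χ x : k) • MonoidAlgebra.of k G x) * twistedSum χ H = twistedSum χ H := by
    rw [smul_mul_assoc, of_mul_twistedSum χ H (h x.2), smul_smul, ← Units.val_mul, ← map_mul]
    simp
  rw [twistedSum_eq χ K, Finset.sum_mul, Finset.sum_congr rfl fun x _ => e x]
  simp [Nat.card_eq_fintype_card, ← Nat.cast_smul_eq_nsmul k]

/-- A product of an element of `H` and one of `K` is 1 only if both lie in the trivial intersection.
-/
theorem coeff_one_twistedSum_mul_twistedSum (χ' : G →* kˣ) {K : Subgroup G} (h : H ⊓ K = ⊥) :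
    (twistedSum χ H * twistedSum χ' K).coeff 1 = 1 := by
  classical
  have : Fintype H := Fintype.ofFinite H
  have : Fintype K := Fintype.ofFinite K
  rw [twistedSum_eq, twistedSum_eq, Finset.sum_mul_sum, MonoidAlgebra.coeff_sum,
    Finset.sum_apply', Finset.sum_eq_single (1 : H)]
  · rw [MonoidAlgebra.coeff_sum, Finset.sum_apply', Finset.sum_eq_single (1 : K)]
    · simp
    · intro b _ hb
      have : (b : G) ≠ 1 := by simpa using hb
      simp [this]
    · simp
  · intro b _ hb
    rw [MonoidAlgebra.coeff_sum, Finset.sum_apply']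
    refine Finset.sum_eq_zero fun x _ => ?_
    have hne : (b : G) * x ≠ 1 := fun he => hb <| by
      have hbK : (b : G) ∈ K := by rw [eq_inv_of_mul_eq_one_left he]; exact K.inv_mem x.2
      have : (b : G) ∈ H ⊓ K := ⟨b.2, hbK⟩
      rw [h, Subgroup.mem_bot] at this
      exact Subtype.ext this
    simp [hne]
  · simp

theorem twistedSum_map {G' : Type*} [Group G'] [Fintype G'] (φ : G →* G')
    (hφ : Function.Injective φ) (χ' : G' →* kˣ) (hχ : ∀ g, χ' (φ g) = χ g) :
    MonoidAlgebra.mapDomainAlgHom k k φ (twistedSum χ H) = twistedSum χ' (H.map φ) := by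
  classical
  have : Fintype H := Fintype.ofFinite H
  have : Fintype (H.map φ) := Fintype.ofFinite _
  rw [twistedSum_eq, twistedSum_eq, map_sum]
  refine Fintype.sum_equiv (H.equivMapOfInjective φ hφ).toEquiv _ _ fun x => ?_
  simp [hχ, MonoidAlgebra.mapDomain_single]

/-- An element of the group algebra of a finite group whose square vanishes has no constant
coefficient, in good characteristic. -/
theorem mul_self_ne_zero_of_coeff_one (hG : (Fintype.card G : k) ≠ 0) {e : MonoidAlgebra k G}
    (he : e.coeff 1 ≠ 0) : e * e ≠ 0 := by
  classical
  intro h0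
  -- Left multiplication by `e` would be nilpotent, hence of trace 0. In the basis of group elements
  -- every diagonal entry is `e.coeff 1`, so the trace is |G| times that coefficient.
  have hn : IsNilpotent (LinearMap.mulLeft k e) := ⟨2, by
    rw [LinearMap.pow_mulLeft, pow_two, h0, LinearMap.mulLeft_zero_eq_zero]⟩
  have htr := (LinearMap.isNilpotent_trace_of_isNilpotent hn).eq_zero
  have e1 (σ : G) : (e * MonoidAlgebra.single σ 1).coeff σ = e.coeff 1 := by
    rw [MonoidAlgebra.coeff_mul_single_eq_coeff_mul 1 (by simp), mul_one]
  rw [LinearMap.trace_eq_matrix_trace k (MonoidAlgebra.basis G k), Matrix.trace] at htr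
  have e2 (σ : G) : (LinearMap.toMatrix (MonoidAlgebra.basis G k) (MonoidAlgebra.basis G k)
      (LinearMap.mulLeft k e)).diag σ = e.coeff 1 := by
    rw [Matrix.diag_apply, LinearMap.toMatrix_apply, ← e1 σ]
    rfl
  rw [Finset.sum_congr rfl fun σ _ => e2 σ] at htr
  simp at htr
  tauto

end TwistedSum

/-! ### Partial trace over the first tensor factor. -/

section PartialTrace

universe v u
variable {C : Type u} [Category.{v} C] [MonoidalCategory C] [SymmetricCategory C]
  [RightRigidCategory C]

/-- The unit `𝟙 ⟶ Xᘁ ⊗ X`. -/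
def coev' (X : C) : 𝟙_ C ⟶ Xᘁ ⊗ X := η_ X Xᘁ ≫ (β_ X Xᘁ).hom

/-- The partial trace over the first factor. -/
def traceFirst (X : C) {W W' : C} (g : X ⊗ W ⟶ X ⊗ W') : W ⟶ W' :=
  (λ_ W).inv ≫ coev' X ▷ W ≫ (α_ _ _ _).hom ≫ Xᘁ ◁ g ≫ (α_ _ _ _).inv ≫ ε_ X Xᘁ ▷ W' ≫
    (λ_ W').hom

theorem traceFirst_comp_whiskerLeft (X : C) {W W' W'' : C} (g : X ⊗ W ⟶ X ⊗ W') (h : W' ⟶ W'') :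
    traceFirst X (g ≫ X ◁ h) = traceFirst X g ≫ h := by
  simp only [traceFirst, MonoidalCategory.whiskerLeft_comp, Category.assoc,
    associator_inv_naturality_right_assoc, whisker_exchange_assoc, leftUnitor_naturality]

theorem traceFirst_whiskerLeft_comp (X : C) {W W' W'' : C} (h : W ⟶ W') (g : X ⊗ W' ⟶ X ⊗ W'') :
    traceFirst X (X ◁ h ≫ g) = h ≫ traceFirst X g := by
  simp only [traceFirst, MonoidalCategory.whiskerLeft_comp, Category.assoc,
    ← associator_naturality_right_assoc, ← whisker_exchange_assoc, leftUnitor_inv_naturality_assoc]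

theorem traceFirst_id (X W : C) :
    traceFirst X (𝟙 (X ⊗ W)) =
      (λ_ W).inv ≫ (η_ X Xᘁ ≫ (β_ X Xᘁ).hom ≫ ε_ X Xᘁ) ▷ W ≫ (λ_ W).hom := by
  simp [traceFirst, coev']

/-- A strand crossing itself once straightens: the hexagon pulls the strand through the loop, and a
zigzag identity removes the loop. -/
theorem trace_braiding (X : C) :
    (λ_ X).inv ≫ coev' X ▷ X ≫ (α_ _ _ _).hom ≫ Xᘁ ◁ (β_ X X).hom ≫ (α_ _ _ _).inv ≫
      ε_ X Xᘁ ▷ X ≫ (λ_ X).hom = 𝟙 X := by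
  have h := BraidedCategory.hexagon_forward X Xᘁ X
  rw [coev', comp_whiskerRight, Category.assoc, ← reassoc_of% h, Iso.hom_inv_id_assoc,
    ← BraidedCategory.braiding_naturality_right_assoc,
    reassoc_of% ExactPairing.evaluation_coevaluation X Xᘁ]
  simp

theorem traceFirst_swapFirst (X W : C) : traceFirst X (swapFirst X W) = 𝟙 (X ⊗ W) := by
  have h := congrArg (fun f => f ▷ W) (trace_braiding X)
  simp only [id_whiskerRight] at h
  rw [← h, traceFirst, swapFirst]
  monoidal

end PartialTrace

/-! ### From partial traces to retractions. -/

section Retraction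

universe v u
variable {C : Type u} [Category.{v} C] [MonoidalCategory C]

/-- The associativity isomorphism `X ^ n ⊗ X ≅ X ^ (n + 1)`. -/
def tensorPowSnoc (X : C) : (n : ℕ) → (tensorPow X n ⊗ X ≅ tensorPow X (n + 1))
  | 0 => λ_ X ≪≫ (ρ_ X).symm
  | n + 1 => α_ X (tensorPow X n) X ≪≫ whiskerLeftIso X (tensorPowSnoc X n)

/-- `g : Y ⊗ A ⟶ Z` becomes a split monomorphism after `Y` is closed up by some `𝟙 ⟶ D ⊗ Y`. -/
def IsSplitAlong {Y A Z : C} (g : Y ⊗ A ⟶ Z) : Prop :=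
  ∃ (D : C) (u : 𝟙_ C ⟶ D ⊗ Y) (r : D ⊗ Z ⟶ A),
    (λ_ A).inv ≫ u ▷ A ≫ (α_ D Y A).hom ≫ D ◁ g ≫ r = 𝟙 A

/-- `theta` has its free factor X in front, while iterated traces leave the last factor free; this
symmetry compares the two. -/
theorem braiding_comp_tensorPowSnoc [SymmetricCategory C] (X : C) : ∀ n : ℕ,
    (β_ X (tensorPow X n)).hom ≫ (tensorPowSnoc X n).hom = moveFirst X n n
  | 0 => by
      simp [tensorPowSnoc, moveFirst]
  | n + 1 => by
      rw [moveFirst, ← braiding_comp_tensorPowSnoc X n]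
      simp only [tensorPowSnoc, Iso.trans_hom, whiskerLeftIso_hom, swapFirst, Category.assoc,
        BraidedCategory.braiding_tensor_right_hom, Iso.inv_hom_id_assoc,
        MonoidalCategory.whiskerLeft_comp]

/-- A partial trace is itself a closure by `coev'` followed by an evaluation. Nesting it in the
given closure replaces `D` by `D ⊗ Xᘁ`. -/
theorem isSplitAlong_of_traceFirst [SymmetricCategory C] [RightRigidCategory C] {X Y A W W' : C}
    (κ : Y ⊗ A ⟶ W) (g : X ⊗ W ⟶ X ⊗ W') (h : IsSplitAlong (κ ≫ traceFirst X g)) :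
    IsSplitAlong ((α_ X Y A).hom ≫ X ◁ κ ≫ g) := by
  obtain ⟨D, u, r, hr⟩ := h
  refine ⟨D ⊗ Xᘁ, u ≫ D ◁ ((λ_ Y).inv ≫ coev' X ▷ Y ≫ (α_ _ _ _).hom) ≫ (α_ _ _ _).inv,
    (α_ _ _ _).hom ≫ D ◁ ((α_ _ _ _).inv ≫ ε_ X Xᘁ ▷ W' ≫ (λ_ W').hom) ≫ r, ?_⟩
  rw [← hr, traceFirst]
  have e : κ ≫ (λ_ W).inv ≫ coev' X ▷ W ≫ (α_ _ _ _).hom =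
      (λ_ _).inv ≫ coev' X ▷ (Y ⊗ A) ≫ (α_ _ _ _).hom ≫ Xᘁ ◁ X ◁ κ := by
    rw [leftUnitor_inv_naturality_assoc, whisker_exchange_assoc, associator_naturality_right]
  rw [reassoc_of% e]
  monoidal

/-- Coevaluation is universal: every 𝟙 ⟶ S ⊗ D factors through `η_ S Sᘁ`. A splitting obtained by
closing `Y` with an arbitrary `u` therefore also splits the map built from the coevaluation of `S`.
-/
theorem isSplitMono_of_isSplitAlong [SymmetricCategory C] [RightRigidCategory C]
    {A Y S Z : C} {π : Y ⟶ S} {g : Y ⊗ A ⟶ Z} (hg : IsSplitAlong g) (p : A ⊗ S ⟶ Z)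
    (h : A ◁ π ≫ p = (β_ A Y).hom ≫ g) :
    IsSplitMono ((ρ_ A).inv ≫ A ◁ η_ S Sᘁ ≫ (α_ A S Sᘁ).inv ≫ p ▷ Sᘁ) := by
  obtain ⟨D, u, r, hr⟩ := hg
  -- `w` is the mate of `v` under duality; the equation is a zigzag identity.
  obtain ⟨w, hw⟩ : ∃ w : Sᘁ ⟶ D, η_ S Sᘁ ≫ S ◁ w = u ≫ (β_ D Y).hom ≫ π ▷ D := by
    set v := u ≫ (β_ D Y).hom ≫ π ▷ D
    refine ⟨(ρ_ _).inv ≫ Sᘁ ◁ v ≫ (α_ _ _ _).inv ≫ ε_ S Sᘁ ▷ D ≫ (λ_ D).hom, ?_⟩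
    have hz := congrArg (fun f => f ▷ D) (ExactPairing.evaluation_coevaluation S Sᘁ)
    have hx : η_ S Sᘁ ≫ (ρ_ _).inv ≫ (S ⊗ Sᘁ) ◁ v =
        v ≫ (λ_ _).inv ≫ η_ S Sᘁ ▷ (S ⊗ D) := by
      rw [rightUnitor_inv_naturality_assoc, ← whisker_exchange, leftUnitor_inv_naturality_assoc,
        unitors_inv_equal]
    calc _ = (η_ S Sᘁ ≫ (ρ_ _).inv ≫ (S ⊗ Sᘁ) ◁ v) ≫ (α_ _ _ _).hom ≫
          S ◁ ((α_ _ _ _).inv ≫ ε_ S Sᘁ ▷ D ≫ (λ_ D).hom) := by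
          simp only [MonoidalCategory.whiskerLeft_comp, Category.assoc]
          monoidal
      _ = v ≫ (λ_ _).inv ≫ (α_ _ _ _).inv ≫ (η_ S Sᘁ ▷ S ≫ (α_ _ _ _).hom ≫
          S ◁ ε_ S Sᘁ) ▷ D ≫ (α_ _ _ _).hom ≫ S ◁ (λ_ D).hom := by
          rw [hx]
          monoidal
      _ = v ≫ (λ_ _).inv ≫ (α_ _ _ _).inv ≫ ((λ_ S).hom ≫ (ρ_ S).inv) ▷ D ≫
          (α_ _ _ _).hom ≫ S ◁ (λ_ D).hom := by rw [← hz]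
      _ = v := by
          rw [← Category.comp_id v]
          simp only [Category.assoc, Category.id_comp]
          congr 1
          monoidal
  refine ⟨⟨⟨Z ◁ w ≫ (β_ Z D).hom ≫ r, ?_⟩⟩⟩
  have e1 : A ◁ η_ S Sᘁ ≫ (α_ A S Sᘁ).inv ≫ p ▷ Sᘁ ≫ Z ◁ w =
      A ◁ u ≫ A ◁ (β_ D Y).hom ≫ (α_ A Y D).inv ≫ ((β_ A Y).hom ≫ g) ▷ D := by
    rw [← whisker_exchange, ← associator_inv_naturality_right_assoc,
      ← MonoidalCategory.whiskerLeft_comp_assoc, hw, ← h]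
    simp
  simp only [Category.assoc]
  rw [reassoc_of% e1, comp_whiskerRight, Category.assoc,
    BraidedCategory.braiding_naturality_left_assoc, BraidedCategory.braiding_tensor_left_hom]
  have h1 := BraidedCategory.hexagon_forward A Y D
  simp only [Category.assoc]
  rw [← reassoc_of% h1]
  simp only [Iso.inv_hom_id_assoc, Iso.hom_inv_id_assoc]
  rw [BraidedCategory.braiding_naturality_right_assoc, ← comp_whiskerRight_assoc,
    SymmetricCategory.symmetry, id_whiskerRight, Category.id_comp,
    BraidedCategory.braiding_naturality_right_assoc, braiding_tensorUnit_right]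
  simpa using hr

theorem isSplitMono_of_isSplitAlong' [SymmetricCategory C] [RightRigidCategory C]
    {A Y S Z Z' : C} {π : Y ⟶ S} {g : Y ⊗ A ⟶ Z} (hg : IsSplitAlong g) (q : A ⊗ S ⟶ Z')
    (m : Z' ⟶ Z) (h : A ◁ π ≫ q ≫ m = (β_ A Y).hom ≫ g) :
    IsSplitMono ((ρ_ A).inv ≫ A ◁ η_ S Sᘁ ≫ (α_ A S Sᘁ).inv ≫ q ▷ Sᘁ) := by
  obtain ⟨⟨r, hr⟩⟩ := isSplitMono_of_isSplitAlong hg (q ≫ m) h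
  exact ⟨⟨⟨m ▷ _ ≫ r, by simpa using hr⟩⟩⟩

end Retraction

/-! ### The stabilizer of the first position. -/

section SuccPerm

/-- The permutation of `Fin (n + 1)` that fixes `0` and acts by `σ` on the successors. -/
noncomputable def succPerm (n : ℕ) : Equiv.Perm (Fin n) →* Equiv.Perm (Fin (n + 1)) :=
  Equiv.Perm.viaEmbeddingHom (Fin.succEmb n)

variable {n : ℕ}

@[simp]
theorem succPerm_succ (σ : Equiv.Perm (Fin n)) (i : Fin n) :
    succPerm n σ i.succ = (σ i).succ :=
  Equiv.Perm.viaEmbedding_apply σ (Fin.succEmb n) i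

@[simp]
theorem succPerm_zero (σ : Equiv.Perm (Fin n)) : succPerm n σ 0 = 0 :=
  Equiv.Perm.viaEmbedding_apply_of_notMem σ (Fin.succEmb n) 0 (by simp)

theorem succPerm_injective : Function.Injective (succPerm n) :=
  Equiv.Perm.viaEmbeddingHom_injective _

theorem sign_succPerm (σ : Equiv.Perm (Fin n)) :
    Equiv.Perm.sign (succPerm n σ) = Equiv.Perm.sign σ := by
  classical
  have h : succPerm n σ = σ.extendDomain (Equiv.ofInjective _ (Fin.succEmb n).injective) := by
    ext x
    refine Fin.cases ?_ (fun x => ?_) x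
    · rw [succPerm_zero, Equiv.Perm.extendDomain_apply_not_subtype _ _ (by simp)]
    · rw [succPerm_succ]
      exact congrArg Fin.val (Equiv.Perm.extendDomain_apply_image σ
        (Equiv.ofInjective _ (Fin.succEmb n).injective) x).symm
  rw [h, Equiv.Perm.sign_extendDomain]

theorem succPerm_mul_swap (σ : Equiv.Perm (Fin n)) (i : Fin n) :
    succPerm n σ * Equiv.swap 0 i.succ = Equiv.swap 0 (σ i).succ * succPerm n σ := by
  rw [Equiv.mul_swap_eq_swap_mul, succPerm_zero, succPerm_succ]

theorem succPerm_swap (i j : Fin n) :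
    succPerm n (Equiv.swap i j) = Equiv.swap i.succ j.succ := by
  ext x
  refine Fin.cases ?_ (fun x => ?_) x
  · rw [succPerm_zero, Equiv.swap_apply_of_ne_of_ne (Fin.succ_ne_zero _).symm
      (Fin.succ_ne_zero _).symm]
  · rw [succPerm_succ, Equiv.swap_apply_def, Equiv.swap_apply_def]
    simp only [Fin.succ_inj]
    split_ifs <;> rfl

/-- The transpositions `swap 0 p` represent the cosets of the stabilizer of 0. The partial trace and
the content functional are both computed coset by coset. -/
theorem exists_eq_swap_mul_succPerm (σ : Equiv.Perm (Fin (n + 1))) :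
    ∃ (p : Fin (n + 1)) (τ : Equiv.Perm (Fin n)), σ = Equiv.swap 0 p * succPerm n τ := by
  obtain ⟨⟨p, τ⟩, rfl⟩ := Equiv.Perm.decomposeFin.symm.surjective σ
  refine ⟨p, τ, Equiv.ext fun x => ?_⟩
  refine Fin.cases ?_ (fun x => ?_) x <;> simp

theorem permTail_succPerm (σ : Equiv.Perm (Fin n)) : permTail (succPerm n σ) = σ :=
  permTail_unique fun i => by simp

theorem permMap_succPerm {C : Type*} [Category C] [MonoidalCategory C] [SymmetricCategory C]
    (X : C) (σ : Equiv.Perm (Fin n)) :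
    permMap X (n + 1) (succPerm n σ) = X ◁ permMap X n σ := by
  have h : moveFirst X n ((succPerm n σ) 0 : Fin (n + 1)) = 𝟙 _ := by
    rw [succPerm_zero]
    cases n <;> simp [moveFirst]
  rw [permMap, permTail_succPerm, h]
  exact Category.comp_id _

end SuccPerm

/-! ### Jucys-Murphy elements and the central content element. -/

section ContentElement

variable {k : Type*} [Field k]

theorem groupAlgebraIncl_of {n : ℕ} (σ : Equiv.Perm (Fin n)) :
    groupAlgebraIncl k n (MonoidAlgebra.of k _ σ) = MonoidAlgebra.of k _ (succPerm n σ) :=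
  MonoidAlgebra.mapDomain_single

variable (k) in
/-- The sum of the transpositions that move `0`. -/
noncomputable def jucysMurphy (n : ℕ) : MonoidAlgebra k (Equiv.Perm (Fin (n + 1))) :=
  ∑ i : Fin n, MonoidAlgebra.of k _ (Equiv.swap 0 i.succ)

/-- The product `∏ (d + J)` over the nonzero Jucys-Murphy elements `J`. -/
noncomputable def contentElement (d : k) :
    (n : ℕ) → MonoidAlgebra k (Equiv.Perm (Fin (n + 1)))
  | 0 => 1
  | n + 1 => groupAlgebraIncl k (n + 1) (contentElement d n) *
      (algebraMap k _ d + jucysMurphy k (n + 1))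

theorem commute_of_forall {G : Type*} [Group G] {x : MonoidAlgebra k G}
    (h : ∀ σ, Commute x (MonoidAlgebra.of k G σ)) (y : MonoidAlgebra k G) : Commute x y := by
  induction y using MonoidAlgebra.induction_on with
  | of m => exact h m
  | add a b ha hb => exact ha.add_right hb
  | smul r a ha => exact ha.smul_right r

/-- Conjugation by a permutation fixing 0 permutes the transpositions that move 0. -/
theorem commute_jucysMurphy_groupAlgebraIncl {n : ℕ} (x : MonoidAlgebra k (Equiv.Perm (Fin n))) :
    Commute (jucysMurphy k n) (groupAlgebraIncl k n x) := by
  induction x using MonoidAlgebra.induction_on with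
  | of σ =>
    rw [groupAlgebraIncl_of, Commute,
      SemiconjBy, jucysMurphy, Finset.sum_mul, Finset.mul_sum]
    refine (Fintype.sum_equiv σ _ _ fun i => ?_).symm
    rw [← map_mul, ← map_mul, succPerm_mul_swap]
  | add a b ha hb => rw [map_add]; exact ha.add_right hb
  | smul r a ha => rw [map_smul]; exact ha.smul_right r

theorem perm_commute_closure {n : ℕ} {x : MonoidAlgebra k (Equiv.Perm (Fin (n + 2)))}
    (h0 : Commute x (MonoidAlgebra.of k _ (Equiv.swap 0 1)))
    (h1 : ∀ σ, Commute x (MonoidAlgebra.of k _ (succPerm (n + 1) σ))) (σ) :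
    Commute x (MonoidAlgebra.of k _ σ) := by
  have h : σ ∈ Submonoid.closure
      (Set.range fun i : Fin (n + 1) => Equiv.swap i.castSucc i.succ) := by
    rw [Equiv.Perm.mclosure_swap_castSucc_succ]; trivial
  induction h using Submonoid.closure_induction with
  | mem y hy =>
    obtain ⟨i, rfl⟩ := hy
    refine Fin.cases h0 (fun j => ?_) i
    have := h1 (Equiv.swap j.castSucc j.succ)
    rwa [succPerm_swap, Fin.succ_castSucc] at this
  | one => rw [map_one]; exact Commute.one_right x
  | mul a b _ _ ha hb => rw [map_mul]; exact ha.mul_right hb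

theorem commute_swap_incl_incl {n : ℕ} (x : MonoidAlgebra k (Equiv.Perm (Fin n))) :
    Commute (groupAlgebraIncl k (n + 1) (groupAlgebraIncl k n x))
      (MonoidAlgebra.of k _ (Equiv.swap 0 1)) := by
  induction x using MonoidAlgebra.induction_on with
  | of σ =>
    rw [groupAlgebraIncl_of, groupAlgebraIncl_of, Commute, SemiconjBy, ← map_mul, ← map_mul,
      Equiv.mul_swap_eq_swap_mul, ← Fin.succ_zero_eq_one, succPerm_zero, succPerm_succ,
      succPerm_zero]
  | add a b ha hb => rw [map_add, map_add]; exact ha.add_left hb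
  | smul r a ha => rw [map_smul, map_smul]; exact ha.smul_left r

/-- This is the degenerate affine Hecke relation: a simple reflection need not commute with two
consecutive Jucys-Murphy elements, but it commutes with their product, and likewise after both are
shifted by d. -/
theorem commute_mul_of_reflection {A : Type*} [Ring A] {s x y : A}
    (hxy : Commute x y) (h : s * y = 1 + x * s) (h' : y * s = 1 + s * x) :
    Commute (x * y) s := by
  have h1 : s * x = y * s - 1 := by rw [h']; abel
  have h2 : x * s = s * y - 1 := by rw [h]; abel
  have e1 : s * (x * y) = y * (x * s) := by
    rw [← mul_assoc, h1, sub_mul, one_mul, mul_assoc, h, mul_add, mul_one]; abel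
  rw [Commute, SemiconjBy, e1, hxy.eq, mul_assoc]

/-- The content element is symmetric in the Jucys-Murphy elements. By induction it commutes with the
stabilizer of 0; for the remaining generator `swap 0 1` only the two outermost factors matter. -/
theorem commute_contentElement (d : k) : ∀ (n : ℕ)
    (x : MonoidAlgebra k (Equiv.Perm (Fin (n + 1)))), Commute (contentElement d n) x
  | 0, x => Commute.one_left x
  | n + 1, x => by
      refine commute_of_forall (perm_commute_closure ?_ fun σ => ?_) x
      · cases n with
        | zero =>
          have : jucysMurphy k 1 = MonoidAlgebra.of k _ (Equiv.swap 0 1) := by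
            simp [jucysMurphy]
          rw [contentElement, contentElement, map_one, one_mul, this]
          exact (Algebra.commute_algebraMap_left _ _).add_left (Commute.refl _)
        | succ n =>
          rw [contentElement, contentElement, map_mul, mul_assoc]
          refine (commute_swap_incl_incl _).mul_left ?_
          set s : MonoidAlgebra k (Equiv.Perm (Fin (n + 1 + 1 + 1))) :=
            MonoidAlgebra.of k _ (Equiv.swap 0 1)
          have hs : s * s = 1 := by rw [← map_mul, Equiv.swap_mul_self, map_one]
          have hJ : jucysMurphy k (n + 1 + 1) =
              s + s * groupAlgebraIncl k (n + 1 + 1) (jucysMurphy k (n + 1)) * s := by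
            rw [jucysMurphy, Fin.sum_univ_succ, jucysMurphy, map_sum, Finset.mul_sum,
              Finset.sum_mul]
            congr 1
            refine Finset.sum_congr rfl fun i _ => ?_
            rw [groupAlgebraIncl_of, ← map_mul, ← map_mul, succPerm_swap, Fin.succ_zero_eq_one,
              Equiv.mul_swap_eq_swap_mul (Equiv.swap 0 1) 1, mul_assoc, Equiv.swap_mul_self, mul_one,
              Equiv.swap_apply_right, Equiv.swap_apply_of_ne_of_ne (Fin.succ_ne_zero _)
                (by rw [← Fin.succ_zero_eq_one, Ne, Fin.succ_inj]; exact Fin.succ_ne_zero _)]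
          have hd (z : MonoidAlgebra k (Equiv.Perm (Fin (n + 1 + 1 + 1)))) :
            z * algebraMap k _ d = algebraMap k _ d * z := (Algebra.commutes _ _).symm
          rw [map_add, AlgHom.commutes]
          refine commute_mul_of_reflection ?_ ?_ ?_
          · exact (Algebra.commute_algebraMap_left _ _).add_left
              ((Algebra.commute_algebraMap_right _ _).add_right
                (commute_jucysMurphy_groupAlgebraIncl _).symm)
          · rw [hJ, mul_add, mul_add, hs, ← mul_assoc, ← mul_assoc, hs, one_mul, add_mul, hd]
            abel
          · rw [hJ, add_mul, add_mul, hs, mul_assoc, hs, mul_one, mul_add, hd]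
            abel
      · rw [contentElement, ← groupAlgebraIncl_of]
        refine Commute.mul_left ?_ ((Algebra.commute_algebraMap_left _ _).add_left
          (commute_jucysMurphy_groupAlgebraIncl _))
        exact (commute_contentElement d n _).map (groupAlgebraIncl k (n + 1))

theorem coeff_one_groupAlgebraIncl_mul {n : ℕ} (x : MonoidAlgebra k (Equiv.Perm (Fin n)))
    {τ : Equiv.Perm (Fin (n + 1))} (hτ : τ 0 ≠ 0) :
    (groupAlgebraIncl k n x * MonoidAlgebra.of k _ τ).coeff 1 = 0 := by
  classical
  induction x using MonoidAlgebra.induction_on with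
  | of σ =>
    have : succPerm n σ * τ ≠ 1 := fun h => hτ <| by
      rw [eq_inv_of_mul_eq_one_right h, ← map_inv, succPerm_zero]
    rw [groupAlgebraIncl_of, ← map_mul]
    simp [this]
  | add a b ha hb => rw [map_add, add_mul, MonoidAlgebra.coeff_add, Finsupp.add_apply, ha, hb,
      add_zero]
  | smul r a ha => rw [map_smul, smul_mul_assoc, MonoidAlgebra.coeff_smul_apply, ha, smul_zero]

theorem coeff_one_groupAlgebraIncl {n : ℕ} (x : MonoidAlgebra k (Equiv.Perm (Fin n))) :
    (groupAlgebraIncl k n x).coeff 1 = x.coeff 1 := by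
  classical
  induction x using MonoidAlgebra.induction_on with
  | of σ =>
    rw [groupAlgebraIncl_of]
    simp [Finsupp.single_apply, map_eq_one_iff _ succPerm_injective]
  | add a b ha hb => simp [ha, hb]
  | smul r a ha => simp [ha]

/-- The functional obeys the same recursion as the partial trace: a fixed first position closes to a
loop of value `d`, and any other `p` only shortens a cycle. -/
theorem coeff_one_mul_contentElement (d : k) {n : ℕ} (p : Fin (n + 2))
    (σ : Equiv.Perm (Fin (n + 1))) :
    (MonoidAlgebra.of k _ (Equiv.swap 0 p * succPerm (n + 1) σ) *
        contentElement d (n + 1)).coeff 1 =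
      (if p = 0 then d else 1) * (MonoidAlgebra.of k _ σ * contentElement d n).coeff 1 := by
  set z := MonoidAlgebra.of k _ σ * contentElement d n with hz
  have e : MonoidAlgebra.of k _ (Equiv.swap 0 p * succPerm (n + 1) σ) * contentElement d (n + 1) =
      MonoidAlgebra.of k _ (Equiv.swap 0 p) *
        (groupAlgebraIncl k _ z * (algebraMap k _ d + jucysMurphy k (n + 1))) := by
    rw [hz, map_mul, map_mul, groupAlgebraIncl_of, contentElement]
    simp only [mul_assoc]
  -- The transposition is cycled to the right end. A summand then survives only if its product with
  -- `swap 0 p` fixes 0, which selects `d` for `p = 0` and the single transposition `swap 0 p`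
  -- otherwise.
  rw [e, coeff_one_mul_comm, mul_assoc, add_mul, mul_add, ← mul_assoc,
    ← Algebra.commutes, mul_assoc, ← Algebra.smul_def, jucysMurphy, Finset.sum_mul,
    Finset.mul_sum, MonoidAlgebra.coeff_add, Finsupp.add_apply, MonoidAlgebra.coeff_sum,
    Finset.sum_apply', MonoidAlgebra.coeff_smul_apply]
  refine Fin.cases ?_ (fun p => ?_) p
  · rw [Equiv.swap_self, if_pos rfl, Finset.sum_eq_zero fun i _ => ?_, add_zero, smul_eq_mul]
    · rw [← Equiv.Perm.one_def, map_one (MonoidAlgebra.of k _), mul_one,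
        coeff_one_groupAlgebraIncl]
    · rw [← map_mul, coeff_one_groupAlgebraIncl_mul]
      simp [Fin.succ_ne_zero]
  · rw [if_neg (Fin.succ_ne_zero p), coeff_one_groupAlgebraIncl_mul, smul_zero, zero_add,
      Finset.sum_eq_single p]
    · rw [← map_mul, Equiv.swap_mul_self, map_one (MonoidAlgebra.of k _), mul_one,
        coeff_one_groupAlgebraIncl, one_mul]
    · intro i _ hi
      rw [← map_mul, coeff_one_groupAlgebraIncl_mul]
      rw [Equiv.Perm.mul_apply, Equiv.swap_apply_left, Equiv.swap_apply_of_ne_of_ne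
        (Fin.succ_ne_zero _) (by simpa using Ne.symm hi)]
      exact Fin.succ_ne_zero _
    · simp
    · simp [Fin.succ_ne_zero]

end ContentElement

/-! ### Traces of permutations. -/

section PermMap

universe v u

variable {C : Type u} [Category.{v} C] [MonoidalCategory C] [SymmetricCategory C]

theorem exists_permMap_eq_moveFirst (X : C) : ∀ n : ℕ,
    ∃ c : Equiv.Perm (Fin (n + 1)), permMap X (n + 1) c = moveFirst X n n
  | 0 => ⟨1, permMap_one X 1⟩
  | n + 1 => by
      obtain ⟨c, hc⟩ := exists_permMap_eq_moveFirst X n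
      refine ⟨succPerm _ c * Equiv.swap (0 : Fin (n + 1)).castSucc (0 : Fin (n + 1)).succ, ?_⟩
      rw [permMap_mul_adjacent, permMap_succPerm, hc]
      rfl

variable [RightRigidCategory C]

/-- Conjugation by a permutation of the untraced factors reduces to `swap 0 1`, and such
permutations pass through the trace. -/
theorem traceFirst_swap_zero_succ (X : C) {n : ℕ} (i : Fin (n + 1)) :
    traceFirst X (permMap X (n + 2) (Equiv.swap 0 i.succ)) = 𝟙 (tensorPow X (n + 1)) := by
  have h : (Equiv.swap 0 i.succ : Equiv.Perm (Fin (n + 2))) =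
      succPerm _ (Equiv.swap 0 i) * Equiv.swap 0 1 * succPerm _ (Equiv.swap 0 i) := by
    rw [← Fin.succ_zero_eq_one, succPerm_mul_swap, mul_assoc, ← map_mul, Equiv.swap_mul_self,
      map_one, mul_one, Equiv.swap_apply_left]
  have h01 : permMap X (n + 2) (Equiv.swap 0 1) = swapFirst X (tensorPow X n) :=
    permAction_adjacent X (n + 1) 0
  rw [h, permMap_mul, permMap_mul, permMap_succPerm, h01, traceFirst_whiskerLeft_comp,
    traceFirst_comp_whiskerLeft, traceFirst_swapFirst]
  erw [Category.id_comp]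
  rw [← permMap_mul, Equiv.swap_mul_self, permMap_one]

end PermMap

/-! ### Iterated partial traces of the group algebra action. -/

section GroupAlgebraAction

universe v u

variable {k : Type*} [Field k] {C : Type u} [Category.{v} C] [Preadditive C] [Linear k C]
  [MonoidalCategory C] [SymmetricCategory C]

theorem groupAlgebraAction_of (X : C) (n : ℕ) (σ : Equiv.Perm (Fin n)) :
    groupAlgebraAction k X n (MonoidAlgebra.of k _ σ) = permMap X n σ := by
  rw [groupAlgebraAction, MonoidAlgebra.lift_of]
  rfl

theorem groupAlgebraAction_mul (X : C) (n : ℕ) (x y : MonoidAlgebra k (Equiv.Perm (Fin n))) :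
    (groupAlgebraAction k X n (x * y) : tensorPow X n ⟶ tensorPow X n) =
      groupAlgebraAction k X n y ≫ groupAlgebraAction k X n x :=
  map_mul (groupAlgebraAction k X n) x y

variable [MonoidalPreadditive C] [MonoidalLinear k C]

theorem groupAlgebraAction_groupAlgebraIncl (X : C) (n : ℕ)
    (x : MonoidAlgebra k (Equiv.Perm (Fin n))) :
    (groupAlgebraAction k X (n + 1) (groupAlgebraIncl k n x) :
      tensorPow X (n + 1) ⟶ tensorPow X (n + 1)) = X ◁ groupAlgebraAction k X n x := by
  induction x using MonoidAlgebra.induction_on with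
  | of σ => rw [groupAlgebraIncl_of, groupAlgebraAction_of, groupAlgebraAction_of,
      permMap_succPerm]
  | add a b ha hb =>
    rw [map_add, map_add, map_add]
    exact (congrArg₂ (· + ·) ha hb).trans (MonoidalPreadditive.whiskerLeft_add _ _).symm
  | smul r a ha =>
    rw [map_smul, map_smul, map_smul]
    exact (congrArg (r • ·) ha).trans (MonoidalLinear.whiskerLeft_smul ..).symm

variable [RightRigidCategory C]

theorem traceFirst_add (X : C) {W W' : C} (f g : X ⊗ W ⟶ X ⊗ W') :
    traceFirst X (f + g) = traceFirst X f + traceFirst X g := by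
  simp [traceFirst]

variable (k) in
theorem traceFirst_smul (X : C) {W W' : C} (r : k) (f : X ⊗ W ⟶ X ⊗ W') :
    traceFirst X (r • f) = r • traceFirst X f := by
  simp [traceFirst]

theorem exists_groupAlgebraAction_eq_traceFirst (X : C) (d : k)
    (hd : η_ X Xᘁ ≫ (β_ X Xᘁ).hom ≫ ε_ X Xᘁ = d • 𝟙 (𝟙_ C)) (n : ℕ)
    (x : MonoidAlgebra k (Equiv.Perm (Fin (n + 2)))) :
    ∃ y : MonoidAlgebra k (Equiv.Perm (Fin (n + 1))),
      groupAlgebraAction k X (n + 1) y =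
        traceFirst X (W := tensorPow X (n + 1)) (W' := tensorPow X (n + 1))
          (groupAlgebraAction k X (n + 2) x) ∧
      (y * contentElement d n).coeff 1 = (x * contentElement d (n + 1)).coeff 1 := by
  induction x using MonoidAlgebra.induction_on with
  | of σ =>
    obtain ⟨p, τ, rfl⟩ := exists_eq_swap_mul_succPerm σ
    refine ⟨(if p = 0 then d else 1) • MonoidAlgebra.of k _ τ, ?_, ?_⟩
    · rw [groupAlgebraAction_of, permMap_mul, permMap_succPerm, traceFirst_whiskerLeft_comp,
        map_smul, groupAlgebraAction_of]
      refine Fin.cases ?_ (fun p => ?_) p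
      · rw [Equiv.swap_self, if_pos rfl, ← Equiv.Perm.one_def, permMap_one, traceFirst_id, hd]
        simp
      · rw [if_neg (Fin.succ_ne_zero p), one_smul, traceFirst_swap_zero_succ]
        exact (Category.comp_id _).symm
    · rw [coeff_one_mul_contentElement, smul_mul_assoc, MonoidAlgebra.coeff_smul_apply,
        smul_eq_mul]
  | add a b ha hb =>
    obtain ⟨y, hy, hy'⟩ := ha
    obtain ⟨z, hz, hz'⟩ := hb
    refine ⟨y + z, ?_, ?_⟩
    · rw [map_add, map_add, hy, hz]
      exact (traceFirst_add X _ _).symm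
    · rw [add_mul, add_mul, MonoidAlgebra.coeff_add, MonoidAlgebra.coeff_add, Finsupp.add_apply,
        Finsupp.add_apply, hy', hz']
  | smul r a ha =>
    obtain ⟨y, hy, hy'⟩ := ha
    refine ⟨r • y, ?_, ?_⟩
    · rw [map_smul, map_smul, hy]
      exact (traceFirst_smul k X _ _).symm
    · rw [smul_mul_assoc, smul_mul_assoc, MonoidAlgebra.coeff_smul_apply,
        MonoidAlgebra.coeff_smul_apply, hy']

/-- One factor is traced out at a time, and the functional keeps its value. With a single factor
left, `x` is a scalar equal to that value, so it can be inverted. -/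
theorem isSplitAlong_groupAlgebraAction (X : C) (d : k)
    (hd : η_ X Xᘁ ≫ (β_ X Xᘁ).hom ≫ ε_ X Xᘁ = d • 𝟙 (𝟙_ C)) : ∀ (n : ℕ)
    (x : MonoidAlgebra k (Equiv.Perm (Fin (n + 1)))),
    (x * contentElement d n).coeff 1 ≠ 0 →
      IsSplitAlong (Y := tensorPow X n) (A := X) (Z := tensorPow X (n + 1))
        ((tensorPowSnoc X n).hom ≫ groupAlgebraAction k X (n + 1) x)
  | 0, x, hx => by
      rw [contentElement, mul_one] at hx
      have e : x = algebraMap k _ (x.coeff 1) := by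
        ext σ
        have : σ = 1 := Equiv.ext fun i => Fin.ext (by omega)
        rw [this]
        simp
      have e' : groupAlgebraAction k X 1 x = x.coeff 1 • 𝟙 (X ⊗ 𝟙_ C) := by
        conv_lhs => rw [e]
        rw [AlgHom.commutes]
        rfl
      refine ⟨𝟙_ C, (λ_ (𝟙_ C)).inv, (λ_ (X ⊗ 𝟙_ C)).hom ≫ ((x.coeff 1)⁻¹ • (ρ_ X).hom :), ?_⟩
      rw [e']
      simp [tensorPowSnoc, hx]
      monoidal
  | n + 1, x, hx => by
      obtain ⟨y, hy, hy'⟩ := exists_groupAlgebraAction_eq_traceFirst X d hd n x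
      have ih := isSplitAlong_groupAlgebraAction X d hd n y (by rwa [hy'])
      rw [hy] at ih
      have := isSplitAlong_of_traceFirst _ _ ih
      simpa [tensorPowSnoc] using this

end GroupAlgebraAction

/-! ### The splitting criterion for `theta`. -/

section Theta

universe w v u

variable (k : Type w) [Field k] {C : Type u} [Category.{v} C] [Abelian C] [Linear k C]
  [MonoidalCategory C] [SymmetricCategory C] [RightRigidCategory C] [IsTensorCategory k C]

theorem dim_spec (X : C) : η_ X Xᘁ ≫ (β_ X Xᘁ).hom ≫ ε_ X Xᘁ = dim k X • 𝟙 (𝟙_ C) := by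
  have h := (Equiv.ofBijective _ (IsTensorCategory.end_unit (k := k) (C := C))).apply_symm_apply
    (η_ X Xᘁ ≫ (β_ X Xᘁ).hom ≫ ε_ X Xᘁ : 𝟙_ C ⟶ 𝟙_ C)
  exact h.symm

variable [MonoidalPreadditive C] [MonoidalLinear k C]

theorem isSplitMono_theta {α β : YoungDiagram} {n : ℕ} (S : Tableau α n)
    (T : Tableau β (n + 1)) (X : C)
    (h : contentElement (dim k X) n *
      (youngSymmetrizer k T * groupAlgebraIncl k n (youngSymmetrizer k S)) ≠ 0) :
    IsSplitMono (theta k S T X) := by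
  obtain ⟨σ, hσ⟩ : ∃ σ, (contentElement (dim k X) n *
      (youngSymmetrizer k T * groupAlgebraIncl k n (youngSymmetrizer k S))).coeff σ ≠ 0 := by
    by_contra! hc
    exact h (MonoidAlgebra.coeff_injective (Finsupp.ext hc))
  obtain ⟨c, hc⟩ := exists_permMap_eq_moveFirst X n
  set z := youngSymmetrizer k T * groupAlgebraIncl k n (youngSymmetrizer k S) with hz
  -- `σ⁻¹` moves the nonzero coefficient to the identity. Conjugation by `c` carries X from the
  -- first position to the last and does not affect the coefficient at 1, since the content element
  -- is central.
  let f := MonoidAlgebra.of k _ (c * σ⁻¹)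
  have hx : (f * z * MonoidAlgebra.of k _ c⁻¹ * contentElement (dim k X) n).coeff 1 ≠ 0 := by
    rw [mul_assoc, coeff_one_mul_comm, mul_assoc, (commute_contentElement _ n _).eq,
      ← mul_assoc, ← mul_assoc, ← map_mul, inv_mul_cancel_left, mul_assoc,
      ← (commute_contentElement _ n _).eq]
    rwa [MonoidAlgebra.of_apply,
      MonoidAlgebra.coeff_single_mul_eq_mul_coeff σ (by simp [inv_mul_eq_one, eq_comm]), one_mul]
  have hsplit := isSplitAlong_groupAlgebraAction X (dim k X) (dim_spec k X) n _ hx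
  let g : tensorPow X (n + 1) ⟶ tensorPow X (n + 1) := groupAlgebraAction k X (n + 1) f
  let π : tensorPow X n ⟶ schur k S X := Limits.factorThruImage (youngMap k S X)
  let ι : schur k S X ⟶ tensorPow X n := Limits.image.ι (youngMap k S X)
  let π' : tensorPow X (n + 1) ⟶ schur k T X := Limits.factorThruImage (youngMap k T X)
  let ι' : schur k T X ⟶ tensorPow X (n + 1) := Limits.image.ι (youngMap k T X)
  have e1 : π ≫ ι = youngMap k S X := Limits.image.fac _
  have e2 : π' ≫ ι' = youngMap k T X := Limits.image.fac _
  refine isSplitMono_of_isSplitAlong' (π := π) hsplit (X ◁ ι ≫ π') (ι' ≫ g) ?_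
  rw [reassoc_of% braiding_comp_tensorPowSnoc X n, ← hc, ← groupAlgebraAction_of (k := k),
    ← groupAlgebraAction_mul, mul_assoc, ← map_mul, inv_mul_cancel, map_one, mul_one,
    groupAlgebraAction_mul, hz, groupAlgebraAction_mul, groupAlgebraAction_groupAlgebraIncl,
    Category.assoc, ← MonoidalCategory.whiskerLeft_comp_assoc, e1, reassoc_of% e2,
    Category.assoc]
  rfl

end Theta

/-! ### Young symmetrizers. -/

section Tableau

variable {n : ℕ}

/-- The permutations that preserve the values of `f`. -/
def fiberPerm {ι : Type*} (f : Fin n → ι) : Subgroup (Equiv.Perm (Fin n)) where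
  carrier := {σ | ∀ i, f (σ i) = f i}
  mul_mem' {a b} ha hb i := (ha (b i)).trans (hb i)
  one_mem' _ := rfl
  inv_mem' {a} ha i := by simpa using (ha (a⁻¹ i)).symm

theorem swap_mem_fiberPerm {ι : Type*} {f : Fin n → ι} {i j : Fin n} (h : f i = f j) :
    Equiv.swap i j ∈ fiberPerm f := fun x => by
  rw [Equiv.swap_apply_def]
  split_ifs with h1 h2
  · rw [h1, h]
  · rw [h2, h]
  · rfl

theorem fiberPerm_inf_eq_bot {ι κ : Type*} {f : Fin n → ι} {g : Fin n → κ}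
    (h : Function.Injective fun i => (f i, g i)) : fiberPerm f ⊓ fiberPerm g = ⊥ :=
  (Subgroup.eq_bot_iff_forall _).2 fun _ hσ =>
    Equiv.ext fun i => h (Prod.ext (hσ.1 i) (hσ.2 i))

theorem map_succPerm_fiberPerm_le {ι : Type*} {f : Fin n → ι} {f' : Fin (n + 1) → ι}
    (h : ∀ i, f' i.succ = f i) : (fiberPerm f).map (succPerm n) ≤ fiberPerm f' := by
  rintro _ ⟨σ, hσ, rfl⟩ i
  refine Fin.cases ?_ (fun i => ?_) i
  · rw [succPerm_zero]
  · rw [succPerm_succ, h, h]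
    exact hσ i

variable (k : Type*) [Field k]

/-- The sign character with values in `k`. -/
noncomputable def signChar (n : ℕ) : Equiv.Perm (Fin n) →* kˣ :=
  (Units.map (Int.castRingHom k).toMonoidHom).comp Equiv.Perm.sign

theorem signChar_swap {i j : Fin n} (h : i ≠ j) : signChar k n (Equiv.swap i j) = -1 := by
  ext
  simp [signChar, Equiv.Perm.sign_swap h]

variable {k}

theorem natCast_card_ne_zero (h : ((n.factorial : ℕ) : k) ≠ 0)
    (H : Subgroup (Equiv.Perm (Fin n))) : (Nat.card H : k) ≠ 0 := fun h0 => h <| by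
  obtain ⟨m, hm⟩ := H.card_subgroup_dvd_card
  rw [Nat.card_perm, Nat.card_fin] at hm
  rw [hm, Nat.cast_mul, h0, zero_mul]

/-- The sum of the permutations that preserve the values of `f`. -/
noncomputable def symmetrizer (k : Type*) [Field k] (f : Fin n → ℕ) :
    MonoidAlgebra k (Equiv.Perm (Fin n)) := twistedSum 1 (fiberPerm f)

/-- The signed sum of the permutations that preserve the values of `f`. -/
noncomputable def antisymmetrizer (k : Type*) [Field k] (f : Fin n → ℕ) :
    MonoidAlgebra k (Equiv.Perm (Fin n)) := twistedSum (signChar k n) (fiberPerm f)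

/-- The row index of the box with a given number. -/
def rowOf {μ : YoungDiagram} (T : Tableau μ n) (i : Fin n) : ℕ := (T i).1.1

/-- The column index of the box with a given number. -/
def colOf {μ : YoungDiagram} (T : Tableau μ n) (i : Fin n) : ℕ := (T i).1.2

theorem injective_rowOf_colOf {μ : YoungDiagram} (T : Tableau μ n) :
    Function.Injective fun i => (rowOf T i, colOf T i) := fun i j h => by
  apply T.injective
  exact Subtype.ext h

theorem rowSymmetrizer_eq {μ : YoungDiagram} (T : Tableau μ n) :
    rowSymmetrizer k T = symmetrizer k (rowOf T) := by
  rw [rowSymmetrizer, symmetrizer, twistedSum]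
  refine Finset.sum_congr (Finset.ext fun σ => ?_) fun _ _ => rfl
  simp only [Finset.mem_filter]
  rfl

theorem colAntisymmetrizer_eq {μ : YoungDiagram} (T : Tableau μ n) :
    colAntisymmetrizer k T = antisymmetrizer k (colOf T) := by
  rw [colAntisymmetrizer, antisymmetrizer, twistedSum]
  refine Finset.sum_congr (Finset.ext fun σ => ?_) fun _ _ => rfl
  simp only [Finset.mem_filter]
  rfl

theorem symmetrizer_mul_of {f : Fin n → ℕ} {σ : Equiv.Perm (Fin n)} (h : σ ∈ fiberPerm f) :
    symmetrizer k f * MonoidAlgebra.of k _ σ = symmetrizer k f := by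
  simpa [symmetrizer] using twistedSum_mul_of (k := k) 1 _ h

theorem of_mul_symmetrizer {f : Fin n → ℕ} {σ : Equiv.Perm (Fin n)} (h : σ ∈ fiberPerm f) :
    MonoidAlgebra.of k _ σ * symmetrizer k f = symmetrizer k f := by
  simpa [symmetrizer] using of_mul_twistedSum (k := k) 1 _ h

theorem swap_mul_antisymmetrizer {f : Fin n → ℕ} {i j : Fin n} (hij : i ≠ j) (h : f i = f j) :
    MonoidAlgebra.of k _ (Equiv.swap i j) * antisymmetrizer k f = -antisymmetrizer k f := by
  rw [antisymmetrizer, of_mul_twistedSum _ _ (swap_mem_fiberPerm h), Equiv.swap_inv,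
    signChar_swap k hij]
  simp

theorem antisymmetrizer_mul_swap {f : Fin n → ℕ} {i j : Fin n} (hij : i ≠ j) (h : f i = f j) :
    antisymmetrizer k f * MonoidAlgebra.of k _ (Equiv.swap i j) = -antisymmetrizer k f := by
  rw [antisymmetrizer, twistedSum_mul_of _ _ (swap_mem_fiberPerm h), Equiv.swap_inv,
    signChar_swap k hij]
  simp

theorem groupAlgebraIncl_symmetrizer (f : Fin n → ℕ) :
    groupAlgebraIncl k n (symmetrizer k f) = twistedSum 1 ((fiberPerm f).map (succPerm n)) :=
  twistedSum_map 1 _ _ succPerm_injective 1 fun _ => rfl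

theorem groupAlgebraIncl_antisymmetrizer (f : Fin n → ℕ) :
    groupAlgebraIncl k n (antisymmetrizer k f) =
      twistedSum (signChar k (n + 1)) ((fiberPerm f).map (succPerm n)) :=
  twistedSum_map _ _ _ succPerm_injective _ fun g => by
    simp [signChar, sign_succPerm]

/-- If `σ` sends two elements with equal `f`-values to elements with equal `g`-values, then `σ`
is killed by antisymmetrization along `g` and symmetrization along `f`. -/
theorem antisymmetrizer_mul_of_mul_symmetrizer_eq_zero (h2 : (2 : k) ≠ 0) {f g : Fin n → ℕ}
    (σ : Equiv.Perm (Fin n)) {i j : Fin n} (hij : i ≠ j) (hf : f i = f j)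
    (hg : g (σ i) = g (σ j)) :
    antisymmetrizer k g * MonoidAlgebra.of k _ σ * symmetrizer k f = 0 := by
  have e : antisymmetrizer k g * MonoidAlgebra.of k _ σ * symmetrizer k f =
      -(antisymmetrizer k g * MonoidAlgebra.of k _ σ * symmetrizer k f) := by
    conv_lhs => rw [← of_mul_symmetrizer (swap_mem_fiberPerm hf), mul_assoc, ← mul_assoc
      (MonoidAlgebra.of k _ σ), ← map_mul, Equiv.mul_swap_eq_swap_mul, map_mul, ← mul_assoc,
      ← mul_assoc, antisymmetrizer_mul_swap (σ.injective.ne hij) hg]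
    simp only [neg_mul]
  rw [eq_neg_iff_add_eq_zero, ← two_smul k] at e
  exact (smul_eq_zero.1 e).resolve_left h2

theorem symmetrizer_mul_of_mul_antisymmetrizer_eq_zero (h2 : (2 : k) ≠ 0) {f g : Fin n → ℕ}
    (σ : Equiv.Perm (Fin n)) {i j : Fin n} (hij : i ≠ j) (hg : g i = g j)
    (hf : f (σ i) = f (σ j)) :
    symmetrizer k f * MonoidAlgebra.of k _ σ * antisymmetrizer k g = 0 := by
  have e : symmetrizer k f * MonoidAlgebra.of k _ σ * antisymmetrizer k g =
      -(symmetrizer k f * MonoidAlgebra.of k _ σ * antisymmetrizer k g) := by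
    conv_lhs => rw [← symmetrizer_mul_of (swap_mem_fiberPerm hf), mul_assoc (symmetrizer k f),
      ← map_mul, ← Equiv.mul_swap_eq_swap_mul, map_mul, mul_assoc, mul_assoc,
      swap_mul_antisymmetrizer hij hg]
    simp only [mul_neg, mul_assoc]
  rw [eq_neg_iff_add_eq_zero, ← two_smul k] at e
  exact (smul_eq_zero.1 e).resolve_left h2

/-- The right side is the minimum of `i` and the length of column `j`; injectivity of `h` on columns
bounds the left side by both. -/
theorem card_lt_le_of_injOn {μ : YoungDiagram} (T : Tableau μ n) (h : Fin n → ℕ)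
    (hinj : ∀ u v, u ≠ v → colOf T u = colOf T v → h u ≠ h v) (i j : ℕ) :
    (Finset.univ.filter fun u => h u < i ∧ colOf T u = j).card ≤
      (Finset.univ.filter fun u => rowOf T u < i ∧ colOf T u = j).card := by
  rcases Nat.lt_or_ge (μ.colLen j) i with hi | hi
  · refine Finset.card_le_card fun u => ?_
    simp only [Finset.mem_filter, Finset.mem_univ, true_and]
    rintro ⟨-, rfl⟩
    exact ⟨(YoungDiagram.mem_iff_lt_colLen.1 (T u).2).trans hi, rfl⟩
  · calc _ = ((Finset.univ.filter fun u => h u < i ∧ colOf T u = j).image h).card := by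
          refine (Finset.card_image_of_injOn fun u hu v hv huv => ?_).symm
          simp only [Finset.coe_filter, Finset.mem_univ, true_and, Set.mem_ofPred_eq] at hu hv
          by_contra hne
          exact hinj u v hne (hu.2.trans hv.2.symm) huv
      _ ≤ (Finset.range i).card := by
          refine Finset.card_le_card fun x hx => ?_
          obtain ⟨u, hu, rfl⟩ := Finset.mem_image.1 hx
          exact Finset.mem_range.2 (Finset.mem_filter.1 hu).2.1
      _ ≤ ((Finset.univ.filter fun u => rowOf T u < i ∧ colOf T u = j).image
            (rowOf T)).card := by
          refine Finset.card_le_card fun x hx => ?_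
          have hx := Finset.mem_range.1 hx
          have hm : (x, j) ∈ μ := YoungDiagram.mem_iff_lt_colLen.2 (hx.trans_le hi)
          refine Finset.mem_image.2 ⟨T.symm ⟨(x, j), hm⟩, ?_, ?_⟩
          · exact Finset.mem_filter.2 ⟨Finset.mem_univ _, by simpa [rowOf], by simp [colOf]⟩
          · simp [rowOf]
      _ ≤ _ := Finset.card_image_le

/-- If `σ` never sends two numbers of the same column to the same row, then `σ` is a product of a
row permutation and a column permutation. -/
theorem exists_eq_mul_of_fiberPerm {μ : YoungDiagram} (T : Tableau μ n) (σ : Equiv.Perm (Fin n))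
    (hinj : ∀ u v, u ≠ v → colOf T u = colOf T v → rowOf T (σ u) ≠ rowOf T (σ v)) :
    ∃ r ∈ fiberPerm (rowOf T), ∃ c ∈ fiberPerm (colOf T), σ = r * c := by
  set h : Fin n → ℕ := fun u => rowOf T (σ u) with hh
  have hmem (u : Fin n) : (h u, colOf T u) ∈ μ := by
    rw [YoungDiagram.mem_iff_lt_colLen]
    -- Summed over all columns, both sides of `card_lt_le_of_injOn` count the boxes in rows below
    -- index `i`, because `σ` is a bijection. Hence equality holds in each column. With `i` the
    -- length of the column of `u`, all values of `h` on that column are less than `i`.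
    set i := μ.colLen (colOf T u) with hi
    set J := Finset.univ.image (colOf T)
    have hle := fun j (_ : j ∈ J) => card_lt_le_of_injOn T h hinj i j
    have hsum : ∑ j ∈ J, (Finset.univ.filter fun u => h u < i ∧ colOf T u = j).card =
        ∑ j ∈ J, (Finset.univ.filter fun u => rowOf T u < i ∧ colOf T u = j).card := by
      have e (f : Fin n → ℕ) :
          ∑ j ∈ J, (Finset.univ.filter fun u => f u < i ∧ colOf T u = j).card =
            (Finset.univ.filter fun u => f u < i).card := by
        rw [Finset.card_eq_sum_card_fiberwise (f := colOf T) (t := J)]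
        · simp only [Finset.filter_filter]
        · intro x _
          exact Finset.mem_coe.2 (Finset.mem_image_of_mem _ (Finset.mem_univ x))
      rw [e, e]
      refine Finset.card_bij (fun u _ => σ u) ?_ (fun _ _ _ _ h => σ.injective h) ?_
      · simp [hh]
      · intro b hb
        exact ⟨σ.symm b, by simpa [hh] using hb, by simp⟩
    have heq := (Finset.sum_eq_sum_iff_of_le hle).1 hsum (colOf T u)
      (Finset.mem_image_of_mem _ (Finset.mem_univ u))
    have h1 : (Finset.univ.filter fun v => rowOf T v < i ∧ colOf T v = colOf T u) =
        Finset.univ.filter fun v => colOf T v = colOf T u := by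
      ext v
      simp only [Finset.mem_filter, Finset.mem_univ, true_and, and_iff_right_iff_imp]
      intro hv
      rw [hi, ← hv]
      exact YoungDiagram.mem_iff_lt_colLen.1 (T v).2
    rw [h1] at heq
    have h2 : (Finset.univ.filter fun v => h v < i ∧ colOf T v = colOf T u) =
        Finset.univ.filter fun v => colOf T v = colOf T u := by
      refine Finset.eq_of_subset_of_card_le (fun v => ?_) heq.ge
      simp only [Finset.mem_filter, Finset.mem_univ, true_and]
      exact And.right
    have hu : u ∈ Finset.univ.filter fun v => h v < i ∧ colOf T v = colOf T u := by
      rw [h2]; simp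
    exact (Finset.mem_filter.1 hu).2.1
  -- Each number moves inside its column to the row where `σ` sends it; what is left of `σ`
  -- preserves rows.
  let c' : Fin n → Fin n := fun u => T.symm ⟨_, hmem u⟩
  have hr (u) : rowOf T (c' u) = h u := by simp [c', rowOf]
  have hc (u) : colOf T (c' u) = colOf T u := by simp [c', colOf]
  have hinj' : Function.Injective c' := fun u v huv => by
    by_contra hne
    refine hinj u v hne ?_ ?_
    · rw [← hc u, ← hc v, huv]
    · change h u = h v
      rw [← hr u, ← hr v, huv]
  let c : Equiv.Perm (Fin n) := Equiv.ofBijective c' (Finite.injective_iff_bijective.1 hinj')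
  refine ⟨σ * c⁻¹, fun i => ?_, c, hc, by simp⟩
  have := hr (c⁻¹ i)
  change rowOf T (c (c⁻¹ i)) = rowOf T (σ (c⁻¹ i)) at this
  rw [← Equiv.Perm.mul_apply c, mul_inv_cancel, Equiv.Perm.one_apply] at this
  exact this.symm

theorem coeff_one_symmetrizer_mul_antisymmetrizer {μ : YoungDiagram} (T : Tableau μ n) :
    (symmetrizer k (rowOf T) * antisymmetrizer k (colOf T)).coeff 1 = 1 :=
  coeff_one_twistedSum_mul_twistedSum _ _ _ (fiberPerm_inf_eq_bot (injective_rowOf_colOf T))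

theorem coeff_one_antisymmetrizer_mul_symmetrizer {μ : YoungDiagram} (T : Tableau μ n) :
    (antisymmetrizer k (colOf T) * symmetrizer k (rowOf T)).coeff 1 = 1 :=
  (coeff_one_mul_comm _ _).trans (coeff_one_symmetrizer_mul_antisymmetrizer T)

/-- Von Neumann's lemma. A permutation that factors as column times row contributes a sign; any
other is killed by a transposition acting as 1 on one side and -1 on the other, which requires 2 ≠
0. -/
theorem exists_antisymmetrizer_mul_mul_symmetrizer (h2 : n ≤ 1 ∨ (2 : k) ≠ 0) {μ : YoungDiagram}
    (T : Tableau μ n) (x : MonoidAlgebra k (Equiv.Perm (Fin n))) :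
    ∃ r : k, antisymmetrizer k (colOf T) * x * symmetrizer k (rowOf T) =
      r • (antisymmetrizer k (colOf T) * symmetrizer k (rowOf T)) := by
  induction x using MonoidAlgebra.induction_on with
  | of σ =>
    by_cases h : ∀ u v, u ≠ v → colOf T u = colOf T v → rowOf T (σ⁻¹ u) ≠ rowOf T (σ⁻¹ v)
    · obtain ⟨r, hr, c, hc, he⟩ := exists_eq_mul_of_fiberPerm T σ⁻¹ h
      obtain rfl : σ = c⁻¹ * r⁻¹ := by rw [← mul_inv_rev, ← he, inv_inv]
      refine ⟨((signChar k n c⁻¹⁻¹ : kˣ) : k), ?_⟩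
      rw [map_mul, mul_assoc, mul_assoc, of_mul_symmetrizer (inv_mem hr), ← mul_assoc,
        antisymmetrizer, twistedSum_mul_of _ _ (inv_mem hc), smul_mul_assoc]
    · push Not at h
      obtain ⟨u, v, huv, hc, hr⟩ := h
      have h2 : (2 : k) ≠ 0 := h2.resolve_left fun hn => huv (Fin.ext (by omega))
      exact ⟨0, by rw [zero_smul, antisymmetrizer_mul_of_mul_symmetrizer_eq_zero h2 σ
        (σ⁻¹.injective.ne huv) hr (by simpa using hc)]⟩
  | add a b ha hb =>
    obtain ⟨r, hr⟩ := ha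
    obtain ⟨s, hs⟩ := hb
    exact ⟨r + s, by rw [mul_add, add_mul, hr, hs, add_smul]⟩
  | smul t a ha =>
    obtain ⟨r, hr⟩ := ha
    exact ⟨t * r, by rw [mul_smul_comm, smul_mul_assoc, hr, smul_smul]⟩

theorem two_ne_zero_of_factorial (h : ((n.factorial : ℕ) : k) ≠ 0) : n ≤ 1 ∨ (2 : k) ≠ 0 := by
  rcases Nat.lt_or_ge n 2 with hn | hn
  · exact Or.inl (by omega)
  · obtain ⟨m, hm⟩ := Nat.dvd_factorial two_pos hn
    exact Or.inr fun h0 => h (by rw [hm, Nat.cast_mul, Nat.cast_ofNat, h0, zero_mul])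

/-- The scalar cannot vanish, since the element has coefficient 1 at the identity and so a nonzero
square. -/
theorem exists_antisymmetrizer_mul_symmetrizer_mul_self (h : ((n.factorial : ℕ) : k) ≠ 0)
    {μ : YoungDiagram} (T : Tableau μ n) : ∃ r : k, r ≠ 0 ∧
      antisymmetrizer k (colOf T) * symmetrizer k (rowOf T) *
        (antisymmetrizer k (colOf T) * symmetrizer k (rowOf T)) =
      r • (antisymmetrizer k (colOf T) * symmetrizer k (rowOf T)) := by
  obtain ⟨r, hr⟩ := exists_antisymmetrizer_mul_mul_symmetrizer (two_ne_zero_of_factorial h) T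
    (symmetrizer k (rowOf T) * antisymmetrizer k (colOf T))
  have e : antisymmetrizer k (colOf T) * symmetrizer k (rowOf T) *
        (antisymmetrizer k (colOf T) * symmetrizer k (rowOf T)) =
      r • (antisymmetrizer k (colOf T) * symmetrizer k (rowOf T)) := by
    rw [← hr]; simp only [mul_assoc]
  refine ⟨r, ?_, e⟩
  rintro rfl
  rw [zero_smul] at e
  refine mul_self_ne_zero_of_coeff_one ?_ ?_ e
  · rwa [Fintype.card_perm, Fintype.card_fin]
  · rw [coeff_one_antisymmetrizer_mul_symmetrizer]
    exact one_ne_zero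

theorem youngSymmetrizer_eq {μ : YoungDiagram} (T : Tableau μ n) :
    youngSymmetrizer k T = symmetrizer k (rowOf T) * antisymmetrizer k (colOf T) := by
  rw [youngSymmetrizer, rowSymmetrizer_eq, colAntisymmetrizer_eq]

theorem symmetrizer_mul_groupAlgebraIncl {f : Fin n → ℕ} {f' : Fin (n + 1) → ℕ}
    (h : ∀ i, f' i.succ = f i) :
    symmetrizer k f' * groupAlgebraIncl k n (symmetrizer k f) =
      (Nat.card ((fiberPerm f).map (succPerm n)) : k) • symmetrizer k f' := by
  rw [groupAlgebraIncl_symmetrizer]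
  exact twistedSum_mul_twistedSum _ _ (map_succPerm_fiberPerm_le h)

theorem groupAlgebraIncl_mul_symmetrizer {f : Fin n → ℕ} {f' : Fin (n + 1) → ℕ}
    (h : ∀ i, f' i.succ = f i) :
    groupAlgebraIncl k n (symmetrizer k f) * symmetrizer k f' =
      (Nat.card ((fiberPerm f).map (succPerm n)) : k) • symmetrizer k f' := by
  rw [groupAlgebraIncl_symmetrizer]
  exact twistedSum_mul_twistedSum' _ _ (map_succPerm_fiberPerm_le h)

theorem antisymmetrizer_mul_groupAlgebraIncl {f : Fin n → ℕ} {f' : Fin (n + 1) → ℕ}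
    (h : ∀ i, f' i.succ = f i) :
    antisymmetrizer k f' * groupAlgebraIncl k n (antisymmetrizer k f) =
      (Nat.card ((fiberPerm f).map (succPerm n)) : k) • antisymmetrizer k f' := by
  rw [groupAlgebraIncl_antisymmetrizer]
  exact twistedSum_mul_twistedSum _ _ (map_succPerm_fiberPerm_le h)

theorem groupAlgebraIncl_mul_antisymmetrizer {f : Fin n → ℕ} {f' : Fin (n + 1) → ℕ}
    (h : ∀ i, f' i.succ = f i) :
    groupAlgebraIncl k n (antisymmetrizer k f) * antisymmetrizer k f' =
      (Nat.card ((fiberPerm f).map (succPerm n)) : k) • antisymmetrizer k f' := by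
  rw [groupAlgebraIncl_antisymmetrizer]
  exact twistedSum_mul_twistedSum' _ _ (map_succPerm_fiberPerm_le h)

theorem youngSymmetrizer_mul_groupAlgebraIncl_ne_zero
    (h : (((n + 1).factorial : ℕ) : k) ≠ 0) {α β : YoungDiagram} (S : Tableau α n)
    (T : Tableau β (n + 1)) (hST : ∀ i : Fin n, (T i.succ : ℕ × ℕ) = S i) :
    youngSymmetrizer k T * groupAlgebraIncl k n (youngSymmetrizer k S) ≠ 0 := by
  intro h0
  have hrow (i : Fin n) : rowOf T i.succ = rowOf S i := congrArg Prod.fst (hST i)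
  have hcol (i : Fin n) : colOf T i.succ = colOf S i := congrArg Prod.snd (hST i)
  have hn : ((n.factorial : ℕ) : k) ≠ 0 := fun h' => h (by
    rw [Nat.factorial_succ, Nat.cast_mul, h', mul_zero])
  obtain ⟨r, hr0, hr⟩ := exists_antisymmetrizer_mul_symmetrizer_mul_self hn S
  have hr := congrArg (groupAlgebraIncl k n) hr
  rw [youngSymmetrizer_eq, youngSymmetrizer_eq, map_mul] at h0
  rw [map_smul, map_mul, map_mul] at hr
  have e1 := antisymmetrizer_mul_groupAlgebraIncl (k := k) hcol
  have e2 := groupAlgebraIncl_mul_symmetrizer (k := k) hrow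
  have c1 := natCast_card_ne_zero h ((fiberPerm (colOf S)).map (succPerm n))
  have c2 := natCast_card_ne_zero h ((fiberPerm (rowOf S)).map (succPerm n))
  set a := symmetrizer k (rowOf T)
  set b := antisymmetrizer k (colOf T) with hb
  set a' := groupAlgebraIncl k n (symmetrizer k (rowOf S))
  set b' := groupAlgebraIncl k n (antisymmetrizer k (colOf S))
  set m : k := (Nat.card ((fiberPerm (colOf S)).map (succPerm n)) : k)
  set l : k := (Nat.card ((fiberPerm (rowOf S)).map (succPerm n)) : k)
  -- Up to invertible scalars, `b` absorbs `b'` and `a` absorbs `a'`, so `b' * a'` can be inserted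
  -- between `b` and `a`. Writing it as a multiple of its square exposes the factor `a * b * (a' *
  -- b')`, assumed to be zero.
  have key : (m * r * l) • (a * b * (a * b)) = 0 := by
    calc (m * r * l) • (a * b * (a * b)) = r • (a * (m • b) * (l • a) * b) := by
          simp only [mul_smul_comm, smul_mul_assoc, smul_smul, mul_assoc]
          congr 1
          ring
      _ = a * b * (r • (b' * a')) * a * b := by
          rw [← e1, ← e2]
          simp only [mul_smul_comm, smul_mul_assoc, mul_assoc]
      _ = a * (b * b') * a' * b' * a' * a * b := by
          rw [← hr]
          simp only [mul_assoc]
      _ = m • ((a * b * (a' * b')) * a' * a * b) := by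
          rw [e1]
          simp only [mul_smul_comm, smul_mul_assoc, mul_assoc]
      _ = 0 := by rw [h0]; simp
  refine mul_self_ne_zero_of_coeff_one ?_ ?_
    ((smul_eq_zero.1 key).resolve_left (mul_ne_zero (mul_ne_zero c1 hr0) c2))
  · rwa [Fintype.card_perm, Fintype.card_fin]
  · rw [coeff_one_symmetrizer_mul_antisymmetrizer]
    exact one_ne_zero

end Tableau

/-! ### Change of tableau by conjugation. -/

section Conjugation

variable {k : Type*} [Field k]

theorem twistedSum_conj {G : Type*} [Group G] [Fintype G] (χ : G →* kˣ) (H : Subgroup G) (g : G) :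
    twistedSum χ (H.map (MulAut.conj g⁻¹).toMonoidHom) =
      MonoidAlgebra.of k G g⁻¹ * twistedSum χ H * MonoidAlgebra.of k G g := by
  classical
  have : Fintype H := Fintype.ofFinite H
  have : Fintype (H.map (MulAut.conj g⁻¹).toMonoidHom) := Fintype.ofFinite _
  rw [twistedSum_eq, twistedSum_eq, Finset.mul_sum, Finset.sum_mul]
  refine (Fintype.sum_equiv (H.equivMapOfInjective _ (MulAut.conj g⁻¹).injective).toEquiv _ _
    fun x => ?_).symm
  change _ = ((χ (g⁻¹ * x * g⁻¹⁻¹) : kˣ) : k) • MonoidAlgebra.of k G (g⁻¹ * x * g⁻¹⁻¹)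
  rw [inv_inv, mul_smul_comm, smul_mul_assoc, ← map_mul, ← map_mul, map_mul χ, map_mul χ,
    map_inv, mul_right_comm, inv_mul_cancel, one_mul]

theorem fiberPerm_comp {ι : Type*} {n : ℕ} (f : Fin n → ι) (g : Equiv.Perm (Fin n)) :
    fiberPerm (f ∘ g) = (fiberPerm f).map (MulAut.conj g⁻¹).toMonoidHom := by
  ext σ
  rw [Subgroup.mem_map]
  constructor
  · intro h
    refine ⟨g * σ * g⁻¹, fun i => ?_, ?_⟩
    · have := h (g⁻¹ i)
      simpa using this
    · change g⁻¹ * (g * σ * g⁻¹) * g⁻¹⁻¹ = σ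
      group
  · rintro ⟨τ, hτ, rfl⟩ i
    have := hτ (g i)
    simpa using this

theorem symmetrizer_comp {n : ℕ} (f : Fin n → ℕ) (g : Equiv.Perm (Fin n)) :
    symmetrizer k (f ∘ g) =
      MonoidAlgebra.of k _ g⁻¹ * symmetrizer k f * MonoidAlgebra.of k _ g := by
  rw [symmetrizer, fiberPerm_comp, twistedSum_conj, symmetrizer]

theorem antisymmetrizer_comp {n : ℕ} (f : Fin n → ℕ) (g : Equiv.Perm (Fin n)) :
    antisymmetrizer k (f ∘ g) =
      MonoidAlgebra.of k _ g⁻¹ * antisymmetrizer k f * MonoidAlgebra.of k _ g := by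
  rw [antisymmetrizer, fiberPerm_comp, twistedSum_conj, antisymmetrizer]

end Conjugation

/-! ### The content element acts on a Young symmetrizer by contents. -/

section Content

variable {k : Type*} [Field k] {n : ℕ} {β : YoungDiagram}

theorem eq_zero_of_le_rowOf_of_le_colOf {T : Tableau β (n + 1)}
    (hT : Maximal (· ∈ β.cells) (T 0 : ℕ × ℕ)) {i : Fin (n + 1)} (h1 : rowOf T 0 ≤ rowOf T i)
    (h2 : colOf T 0 ≤ colOf T i) : i = 0 :=
  T.injective (Subtype.ext (hT.eq_of_ge (T i).2 ⟨h1, h2⟩))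

theorem exists_rowOf_eq_colOf_eq (T : Tableau β n) {i j : ℕ} (h : (i, j) ∈ β) :
    ∃ u, rowOf T u = i ∧ colOf T u = j :=
  ⟨T.symm ⟨(i, j), h⟩, by simp [rowOf], by simp [colOf]⟩

theorem mem_of_le_rowOf_of_le_colOf (T : Tableau β n) (u : Fin n) {i j : ℕ} (hi : i ≤ rowOf T u)
    (hj : j ≤ colOf T u) : (i, j) ∈ β :=
  β.up_left_mem hi hj (T u).2

/-- A corner ends its row, so its column index, counted from 0, is the number of other boxes in that
row. -/
theorem card_row_eq {T : Tableau β (n + 1)} (hT : Maximal (· ∈ β.cells) (T 0 : ℕ × ℕ)) :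
    (Finset.univ.filter fun i : Fin n => rowOf T i.succ = rowOf T 0).card = colOf T 0 := by
  rw [← Finset.card_range (colOf T 0)]
  refine Finset.card_bij (fun i _ => colOf T i.succ) ?_ ?_ ?_
  · intro i hi
    have hi := (Finset.mem_filter.1 hi).2
    rw [Finset.mem_range]
    by_contra! hc
    exact Fin.succ_ne_zero i (eq_zero_of_le_rowOf_of_le_colOf hT hi.ge hc)
  · intro i hi j hj hij
    have hi := (Finset.mem_filter.1 hi).2
    have hj := (Finset.mem_filter.1 hj).2
    exact Fin.succ_injective _ (injective_rowOf_colOf T (Prod.ext (hi.trans hj.symm) hij))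
  · intro c hc
    have hc := Finset.mem_range.1 hc
    obtain ⟨u, hu1, hu2⟩ := exists_rowOf_eq_colOf_eq T
      (mem_of_le_rowOf_of_le_colOf T 0 le_rfl hc.le)
    have hu0 : u ≠ 0 := by rintro rfl; omega
    obtain ⟨i, rfl⟩ := Fin.exists_succ_eq.2 hu0
    exact ⟨i, by simpa using hu1, hu2⟩

theorem card_col_eq {T : Tableau β (n + 1)} (hT : Maximal (· ∈ β.cells) (T 0 : ℕ × ℕ)) :
    (Finset.univ.filter fun i : Fin n => colOf T i.succ = colOf T 0).card = rowOf T 0 := by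
  rw [← Finset.card_range (rowOf T 0)]
  refine Finset.card_bij (fun i _ => rowOf T i.succ) ?_ ?_ ?_
  · intro i hi
    have hi := (Finset.mem_filter.1 hi).2
    rw [Finset.mem_range]
    by_contra! hc
    exact Fin.succ_ne_zero i (eq_zero_of_le_rowOf_of_le_colOf hT hc hi.ge)
  · intro i hi j hj hij
    have hi := (Finset.mem_filter.1 hi).2
    have hj := (Finset.mem_filter.1 hj).2
    exact Fin.succ_injective _ (injective_rowOf_colOf T (Prod.ext hij (hi.trans hj.symm)))
  · intro c hc
    have hc := Finset.mem_range.1 hc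
    obtain ⟨u, hu1, hu2⟩ := exists_rowOf_eq_colOf_eq T
      (mem_of_le_rowOf_of_le_colOf T 0 hc.le le_rfl)
    have hu0 : u ≠ 0 := by rintro rfl; omega
    obtain ⟨i, rfl⟩ := Fin.exists_succ_eq.2 hu0
    exact ⟨i, by simpa using hu2, hu1⟩

theorem symmetrizer_mul_swap_mul_antisymmetrizer (h2 : (2 : k) ≠ 0) {T : Tableau β (n + 1)}
    (hT : Maximal (· ∈ β.cells) (T 0 : ℕ × ℕ)) (y : Fin (n + 1)) (hy : y ≠ 0) :
    symmetrizer k (rowOf T) * MonoidAlgebra.of k _ (Equiv.swap 0 y) *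
        antisymmetrizer k (colOf T) =
      ((if rowOf T y = rowOf T 0 then 1 else 0) - (if colOf T y = colOf T 0 then 1 else 0) : k) •
        (symmetrizer k (rowOf T) * antisymmetrizer k (colOf T)) := by
  by_cases hr : rowOf T y = rowOf T 0
  · have hc : colOf T y ≠ colOf T 0 := fun hc => hy (injective_rowOf_colOf T (Prod.ext hr hc))
    rw [symmetrizer_mul_of (swap_mem_fiberPerm hr.symm), if_pos hr, if_neg hc, sub_zero, one_smul]
  by_cases hc : colOf T y = colOf T 0
  · rw [mul_assoc, swap_mul_antisymmetrizer hy.symm hc.symm, if_neg hr, if_pos hc, zero_sub,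
      neg_smul, one_smul, mul_neg]
  rw [if_neg hr, if_neg hc, sub_zero, zero_smul]
  -- `z` completes a rectangle with the boxes of 0 and `y`. It shares a column with one of them, and
  -- the transposition brings that pair into one row, so the product vanishes. When `y` lies lower,
  -- maximality of the corner places it further left.
  rcases lt_or_gt_of_ne hr with hlt | hgt
  · obtain ⟨z, hz1, hz2⟩ := exists_rowOf_eq_colOf_eq T
      (mem_of_le_rowOf_of_le_colOf T 0 hlt.le le_rfl)
    have hz0 : z ≠ 0 := by rintro rfl; omega
    have hzy : z ≠ y := by rintro rfl; exact hc hz2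
    refine symmetrizer_mul_of_mul_antisymmetrizer_eq_zero h2 _ hz0 hz2 ?_
    rw [Equiv.swap_apply_of_ne_of_ne hz0 hzy, Equiv.swap_apply_left, hz1]
  · have hlt : colOf T y < colOf T 0 := by
      by_contra! hge
      exact hy (eq_zero_of_le_rowOf_of_le_colOf hT hgt.le hge)
    obtain ⟨z, hz1, hz2⟩ := exists_rowOf_eq_colOf_eq T
      (mem_of_le_rowOf_of_le_colOf T 0 le_rfl hlt.le)
    have hz0 : z ≠ 0 := by rintro rfl; omega
    have hzy : z ≠ y := by rintro rfl; omega
    refine symmetrizer_mul_of_mul_antisymmetrizer_eq_zero h2 _ hzy hz2 ?_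
    rw [Equiv.swap_apply_of_ne_of_ne hz0 hzy, Equiv.swap_apply_right, hz1]

theorem symmetrizer_mul_jucysMurphy_mul_antisymmetrizer (h2 : n = 0 ∨ (2 : k) ≠ 0)
    {T : Tableau β (n + 1)} (hT : Maximal (· ∈ β.cells) (T 0 : ℕ × ℕ)) :
    symmetrizer k (rowOf T) * jucysMurphy k n * antisymmetrizer k (colOf T) =
      ((colOf T 0 : k) - (rowOf T 0 : k)) •
        (symmetrizer k (rowOf T) * antisymmetrizer k (colOf T)) := by
  rw [jucysMurphy, Finset.mul_sum, Finset.sum_mul]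
  rw [Finset.sum_congr rfl fun i _ => symmetrizer_mul_swap_mul_antisymmetrizer
    (h2.resolve_left fun h => (Fin.cast h i).elim0) hT i.succ (Fin.succ_ne_zero i)]
  rw [← Finset.sum_smul, Finset.sum_sub_distrib, Finset.sum_boole, Finset.sum_boole,
    card_row_eq hT, card_col_eq hT]

theorem exists_tableau_erase {β : YoungDiagram} (hβ : β.card = n + 2) :
    ∃ (α : YoungDiagram) (S : Tableau α (n + 1)) (T : Tableau β (n + 2)),
      Maximal (· ∈ β.cells) (T 0 : ℕ × ℕ) ∧ (T 0 : ℕ × ℕ) ≠ (0, 0) ∧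
      α.cells = β.cells.erase (T 0) ∧ ∀ i, (T i.succ : ℕ × ℕ) = S i := by
  have hβ' : β.cells.card = n + 2 := hβ
  obtain ⟨x, hx⟩ := Finset.exists_maximal (s := β.cells) (Finset.card_pos.1 (by omega))
  have hx0 : x ≠ (0, 0) := by
    rintro rfl
    have : β.cells ⊆ {(0, 0)} := fun y hy =>
      Finset.mem_singleton.2 (hx.eq_of_ge hy ⟨Nat.zero_le _, Nat.zero_le _⟩)
    have := Finset.card_le_card this
    rw [Finset.card_singleton] at this
    omega
  let α : YoungDiagram := ⟨β.cells.erase x, fun a b hba ha => by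
    have ha : a ∈ β.cells.erase x := ha
    rw [Finset.mem_erase] at ha
    refine Finset.mem_coe.2 (Finset.mem_erase.2 ⟨?_, β.isLowerSet hba ha.2⟩)
    rintro rfl
    exact ha.1 (hx.eq_of_ge ha.2 hba)⟩
  have hα : α.cells.card = n + 1 := by
    have := Finset.card_erase_of_mem hx.prop
    change (β.cells.erase x).card = _
    omega
  let S : Tableau α (n + 1) := (Finset.equivFinOfCardEq hα).symm
  have hS (i) : (S i : ℕ × ℕ) ∈ β.cells ∧ (S i : ℕ × ℕ) ≠ x :=
    (Finset.mem_erase.1 (S i).2).symm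
  let t : Fin (n + 2) → β.cells := Fin.cons ⟨x, hx.prop⟩ fun i => ⟨S i, (hS i).1⟩
  have ht : Function.Injective t := by
    rw [Fin.cons_injective_iff]
    refine ⟨?_, fun i j hij => S.injective (Subtype.ext (congrArg (fun c : β.cells => (c : ℕ × ℕ)) hij))⟩
    rintro ⟨i, hi⟩
    exact (hS i).2 (congrArg Subtype.val hi)
  refine ⟨α, S, Equiv.ofBijective t ((Fintype.bijective_iff_injective_and_card t).2
    ⟨ht, by simp [hβ']⟩), hx, hx0, rfl, fun i => rfl⟩

/-- Induction by removal of a corner: the last factor d + J contributes the content of the corner,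
and the other factors come from the smaller diagram. The box (0, 0) contributes nothing because the
product omits the zero Jucys-Murphy element. -/
theorem symmetrizer_mul_contentElement_mul_antisymmetrizer (d : k) : ∀ {n : ℕ}
    (_ : (((n + 1).factorial : ℕ) : k) ≠ 0) {β : YoungDiagram} (T : Tableau β (n + 1)),
    symmetrizer k (rowOf T) * contentElement d n * antisymmetrizer k (colOf T) =
      (∏ c ∈ β.cells.erase (0, 0), (d + ((c.2 : k) - (c.1 : k)))) •
        (symmetrizer k (rowOf T) * antisymmetrizer k (colOf T))
  | 0, _, β, T => by
      have h1 : β.cells.erase (0, 0) = ∅ := by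
        have hc : β.cells.card = 1 := by simpa using (Fintype.card_congr T).symm
        have h0 : (0, 0) ∈ β.cells := mem_of_le_rowOf_of_le_colOf T 0 (Nat.zero_le _)
          (Nat.zero_le _)
        rw [← Finset.card_eq_zero, Finset.card_erase_of_mem h0, hc]
      rw [h1, Finset.prod_empty, one_smul, contentElement, mul_one]
  | n + 1, h, β, T => by
      have hβ : β.card = n + 2 := by simpa using (Fintype.card_congr T).symm
      obtain ⟨α, S, T₀, hT, hT0, hα, hST⟩ := exists_tableau_erase hβ
      have hrow (i) : rowOf T₀ i.succ = rowOf S i := congrArg Prod.fst (hST i)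
      have hcol (i) : colOf T₀ i.succ = colOf S i := congrArg Prod.snd (hST i)
      have hn : (((n + 1).factorial : ℕ) : k) ≠ 0 := fun h' => h (by
        rw [Nat.factorial_succ, Nat.cast_mul, h', mul_zero])
      have key : symmetrizer k (rowOf T₀) * contentElement d (n + 1) *
          antisymmetrizer k (colOf T₀) =
          (∏ c ∈ β.cells.erase (0, 0), (d + ((c.2 : k) - (c.1 : k)))) •
            (symmetrizer k (rowOf T₀) * antisymmetrizer k (colOf T₀)) := by
        have ih := congrArg (groupAlgebraIncl k (n + 1))
          (symmetrizer_mul_contentElement_mul_antisymmetrizer d hn S)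
        rw [map_smul, map_mul, map_mul, map_mul] at ih
        have e1 := symmetrizer_mul_groupAlgebraIncl (k := k) hrow
        have e2 := groupAlgebraIncl_mul_antisymmetrizer (k := k) hcol
        have c1 := natCast_card_ne_zero h ((fiberPerm (rowOf S)).map (succPerm (n + 1)))
        have c2 := natCast_card_ne_zero h ((fiberPerm (colOf S)).map (succPerm (n + 1)))
        have hy := (Algebra.commute_algebraMap_left d _).add_left
          (commute_jucysMurphy_groupAlgebraIncl (antisymmetrizer k (colOf S)))
        have h2 := (two_ne_zero_of_factorial h).resolve_left (by omega)
        have hJ := symmetrizer_mul_jucysMurphy_mul_antisymmetrizer (Or.inr h2) hT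
        rw [← Finset.mul_prod_erase _ _ (Finset.mem_erase.2 ⟨hT0, (T₀ 0).2⟩),
          Finset.erase_right_comm, ← hα, contentElement]
        set P := ∏ c ∈ α.cells.erase (0, 0), (d + ((c.2 : k) - (c.1 : k)))
        set a := symmetrizer k (rowOf T₀)
        set b := antisymmetrizer k (colOf T₀)
        set a' := groupAlgebraIncl k (n + 1) (symmetrizer k (rowOf S))
        set b' := groupAlgebraIncl k (n + 1) (antisymmetrizer k (colOf S))
        set R := groupAlgebraIncl k (n + 1) (contentElement d n)
        set l : k := (Nat.card ((fiberPerm (rowOf S)).map (succPerm (n + 1))) : k)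
        set m : k := (Nat.card ((fiberPerm (colOf S)).map (succPerm (n + 1))) : k)
        set y := algebraMap k (MonoidAlgebra k (Equiv.Perm (Fin (n + 1 + 1)))) d +
          jucysMurphy k (n + 1) with hyd
        have hy' : a * y * b = (d + ((colOf T₀ 0 : k) - (rowOf T₀ 0 : k))) • (a * b) := by
          rw [hyd, mul_add, add_mul, hJ, ← Algebra.commutes, mul_assoc, ← Algebra.smul_def,
            ← add_smul]
        refine smul_right_injective _ (mul_ne_zero c1 c2) ?_
        change (l * m) • (a * (R * y) * b) = (l * m) •
          ((d + ((colOf T₀ 0 : k) - (rowOf T₀ 0 : k))) * P) • (a * b)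
        -- `a'` and `b'` are split off from `a` and `b`. Since `y` commutes with `b'`, the block `a'
        -- * R * b'` forms and the induction hypothesis applies.
        calc (l * m) • (a * (R * y) * b) = (l • a) * R * y * (m • b) := by
              simp only [mul_smul_comm, smul_mul_assoc, smul_smul, mul_assoc, mul_comm m l]
          _ = a * a' * R * (y * b') * b := by
              rw [← e1, ← e2]
              simp only [mul_assoc]
          _ = a * (a' * R * b') * y * b := by
              rw [hy.eq]
              simp only [mul_assoc]
          _ = P • (a * a' * (b' * y) * b) := by
              rw [ih]
              simp only [mul_smul_comm, smul_mul_assoc, mul_assoc]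
          _ = P • (a * a' * y * (b' * b)) := by
              rw [← hy.eq]
              simp only [mul_assoc]
          _ = (P * l * m) • (a * y * b) := by
              rw [e1, e2]
              simp only [mul_smul_comm, smul_mul_assoc, smul_smul]
              congr 1
              ring
          _ = _ := by
              rw [hy', smul_smul, smul_smul]
              congr 1
              ring
      -- Any tableau is a renumbering of `T₀`, and conjugation by `g` fixes the central content
      -- element.
      let g : Equiv.Perm (Fin (n + 2)) := T.trans T₀.symm
      have hr : rowOf T = rowOf T₀ ∘ g := by ext i; simp [rowOf, g]
      have hc : colOf T = colOf T₀ ∘ g := by ext i; simp [colOf, g]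
      rw [hr, hc, symmetrizer_comp, antisymmetrizer_comp]
      have hg : MonoidAlgebra.of k (Equiv.Perm (Fin (n + 2))) g *
          MonoidAlgebra.of k (Equiv.Perm (Fin (n + 2))) g⁻¹ = 1 := by
        rw [← map_mul, mul_inv_cancel, map_one]
      set a := symmetrizer k (rowOf T₀)
      set b := antisymmetrizer k (colOf T₀)
      set G := MonoidAlgebra.of k (Equiv.Perm (Fin (n + 2))) g
      set G' := MonoidAlgebra.of k (Equiv.Perm (Fin (n + 2))) g⁻¹
      calc G' * a * G * contentElement d (n + 1) * (G' * b * G) =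
          G' * a * (G * contentElement d (n + 1) * G') * b * G := by simp only [mul_assoc]
        _ = G' * (a * contentElement d (n + 1) * b) * G := by
          rw [← (commute_contentElement d (n + 1) G).eq, mul_assoc _ G G', hg, mul_one]
          simp only [mul_assoc]
        _ = (∏ c ∈ β.cells.erase (0, 0), (d + ((c.2 : k) - (c.1 : k)))) •
            (G' * a * (G * G') * b * G) := by
          rw [key, hg, mul_one]
          simp only [mul_smul_comm, smul_mul_assoc, mul_assoc]
        _ = _ := by simp only [mul_assoc]

end Content

/-! ### Assembly: characteristic, contents and the range of excluded dimensions. -/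

section Main

theorem contentElement_mul_youngSymmetrizer {k : Type*} [Field k] {n : ℕ}
    (h : (((n + 1).factorial : ℕ) : k) ≠ 0) (d : k) {β : YoungDiagram}
    (T : Tableau β (n + 1)) :
    contentElement d n * youngSymmetrizer k T =
      (∏ c ∈ β.cells.erase (0, 0), (d + ((c.2 : k) - (c.1 : k)))) • youngSymmetrizer k T := by
  rw [youngSymmetrizer_eq, ← symmetrizer_mul_contentElement_mul_antisymmetrizer d h T,
    ← mul_assoc, (commute_contentElement d n _).eq]

theorem factorial_ne_zero_of_lt_ringChar {k : Type*} [Field k] {m : ℕ}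
    (h : ringChar k = 0 ∨ m < ringChar k) : ((m.factorial : ℕ) : k) ≠ 0 := by
  intro h0
  have hd := (ringChar.spec k _).1 h0
  rcases h with h | h
  · rw [h, zero_dvd_iff] at hd
    exact Nat.factorial_ne_zero m hd
  · have hp : (ringChar k).Prime :=
      (CharP.char_is_prime_or_zero k (ringChar k)).resolve_right (by omega)
    exact absurd ((hp.dvd_factorial).1 hd) (by omega)

theorem isSplitMono_theta_of_content_ne_zero (k : Type*) [Field k] {C : Type*} [Category C]
    [Abelian C] [Linear k C] [MonoidalCategory C] [MonoidalPreadditive C] [MonoidalLinear k C]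
    [SymmetricCategory C] [RightRigidCategory C] [IsTensorCategory k C] (X : C) {n : ℕ}
    (hn : (((n + 1).factorial : ℕ) : k) ≠ 0) {α β : YoungDiagram} (S : Tableau α n)
    (T : Tableau β (n + 1))
    (hST : youngSymmetrizer k T * groupAlgebraIncl k n (youngSymmetrizer k S) ≠ 0)
    (hd : ∀ i j : ℕ, (i, j) ∈ β → (i, j) ≠ (0, 0) → dim k X ≠ (((i : ℤ) - (j : ℤ) : ℤ) : k)) :
    IsSplitMono (theta k S T X) := by
  refine isSplitMono_theta k S T X ?_
  rw [← mul_assoc, contentElement_mul_youngSymmetrizer hn, smul_mul_assoc]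
  refine smul_ne_zero (Finset.prod_ne_zero_iff.2 fun c hc h0 => ?_) hST
  rw [Finset.mem_erase] at hc
  refine hd c.1 c.2 hc.2 hc.1 ?_
  push_cast
  linear_combination h0

end Main

end SchurFunctor

theorem mainTheorem7 (k : Type*) [Field k] {C : Type*} [Category C] [Abelian C] [Linear k C]
    [MonoidalCategory C] [MonoidalPreadditive C] [MonoidalLinear k C] [SymmetricCategory C]
    [RigidCategory C] [SchurFunctor.IsTensorCategory k C] (X : C) (n : ℕ)
    (hchar : ringChar k = 0 ∨ n + 1 < ringChar k) (α β : YoungDiagram) (hα : α.card = n)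
    (hβ : β.card = n + 1) (hαβ : α ≤ β) :
    (∀ (S : SchurFunctor.Tableau α n) (T : SchurFunctor.Tableau β (n + 1)),
      (∀ i : Fin n, (T i.succ : ℕ × ℕ) = S i) →
        SchurFunctor.youngSymmetrizer k T *
          SchurFunctor.groupAlgebraIncl k n (SchurFunctor.youngSymmetrizer k S) ≠ 0) ∧
    (∀ (S : SchurFunctor.Tableau α n) (T : SchurFunctor.Tableau β (n + 1)),
      SchurFunctor.youngSymmetrizer k T *
          SchurFunctor.groupAlgebraIncl k n (SchurFunctor.youngSymmetrizer k S) ≠ 0 →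
        ((∀ i : ℤ, 1 - (β.rowLen 0 : ℤ) ≤ i → i ≤ (β.colLen 0 : ℤ) - 1 →
            SchurFunctor.dim k X ≠ (i : k)) →
          IsSplitMono (SchurFunctor.theta k S T X)) ∧
        (SchurFunctor.IsHook β →
          (∀ i : ℤ, 1 - (β.rowLen 0 : ℤ) ≤ i → i ≤ (β.colLen 0 : ℤ) - 1 → i ≠ 0 →
            SchurFunctor.dim k X ≠ (i : k)) →
          IsSplitMono (SchurFunctor.theta k S T X))) := by
  have hn := SchurFunctor.factorial_ne_zero_of_lt_ringChar hchar
  -- The extreme values of i - j are attained at the ends of the first row and the first column.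
  have hbox (i j : ℕ) (h : (i, j) ∈ β) :
      1 - (β.rowLen 0 : ℤ) ≤ (i : ℤ) - j ∧ (i : ℤ) - j ≤ (β.colLen 0 : ℤ) - 1 := by
    have h1 := YoungDiagram.mem_iff_lt_rowLen.1 (β.up_left_mem (Nat.zero_le i) le_rfl h)
    have h2 := YoungDiagram.mem_iff_lt_colLen.1 (β.up_left_mem le_rfl (Nat.zero_le j) h)
    omega
  refine ⟨fun S T h => SchurFunctor.youngSymmetrizer_mul_groupAlgebraIncl_ne_zero hn S T h,
    fun S T hST => ⟨fun hd => ?_, fun hook hd => ?_⟩⟩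
  · exact SchurFunctor.isSplitMono_theta_of_content_ne_zero k X hn S T hST
      fun i j h _ => hd _ (hbox i j h).1 (hbox i j h).2
  · refine SchurFunctor.isSplitMono_theta_of_content_ne_zero k X hn S T hST
      fun i j h h0 => hd _ (hbox i j h).1 (hbox i j h).2 fun hij => ?_
    -- A box with i = j other than (0, 0) has (1, 1) weakly above and to its left, which a hook
    -- forbids.
    have hi : 1 ≤ i := Nat.one_le_iff_ne_zero.2 fun hi => h0 (Prod.ext hi (by grind))
    exact hook (β.up_left_mem hi (by omega) h)
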